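/- **Conventions.** Let $M$ be an $n$-dimensional smooth manifold. For $U\subseteq M$, a *conical region over $U$* is an open set $\mathcal C\subset TM\setminus\{0\}$ with $\lambda y\in\mathcal C$ whenever $y\in\mathcal C$, $\lambda>0$, and such that $\mathcal C_x=\mathcal C\cap T_xM$ is nonempty exactly for $x\in U$. A *spray* $\mathbf G$ on $M$ is a smooth vector field on a conical region $\mathcal C(\mathbf G)$ over $M$ of the local form $y^i\frac{\partial}{\partial x^i}-2G^i\frac{\partial}{\partial y^i}$, $G^i(x,\lambda y)=\lambda^2G^i(x,y)$ for $\lambda>0$. With $\partial_k=\partial/\partial x^k$, $\dot\partial_k=\partial/\partial y^k$, its Riemann curvature is $$R^i{}_k=2\partial_kG^i-y^j\partial_j\dot\partial_kG^i+2G^j\dot\partial_j\dot\partial_kG^i-(\dot\partial_jG^i)(\dot\partial_kG^j).$$ For $T=T_i\,dx^i$ put $T_{i;j}=(\partial_j-(\dot\partial_jG^r)\dot\partial_r)T_i-T_r\,\dot\partial_i\dot\partial_jG^r$ and $T_{i.j}=\dot\partial_jT_i$. $\mathbf G$ is *of scalar curvature* if $R^i{}_k=R\,\delta^i_k-\tau_ky^i$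 on $\mathcal C(\mathbf G)$ with a smooth function $R$ and a smooth covector $\tau_k\,dx^k$ on $\mathcal C(\mathbf G)$, positively homogeneous in $y$ of degrees $2$ and $1$. A *Finsler metric* over $U$ on a conical region $\mathcal C$ over $U$ is a smooth $L:\mathcal C\to\mathbb R$, not identically zero on any fibre $\mathcal C_x$ ($x\in U$), positively homogeneous of degree $2$ in $y$, with $g_{ij}=\frac12\dot\partial_i\dot\partial_jL$ nondegenerate. Say that $\mathbf G$ is *Finsler-metrizable over $U$ on $\mathcal C$* if $\mathcal C\subseteq\mathcal C(\mathbf G)$ and there is such an $L$ with $G^i=\frac14g^{il}\{L_{x^ky^l}y^k-L_{x^l}\}$ on $\mathcal C$; and that $\mathbf G$ is *locally Finsler-metrizable* if every $x\in M$ has an open neighbourhood $U$ over which $\mathbf G$ is Finsler-metrizable on some conical region. **Theorem.** Let $\mathbf G$ be a spray of scalar curvature, $R^i{}_k=R\,\delta^i_k-\tau_ky^i$, on $M$. (i) If $R=0$ and $\tau_k=0$ on $\mathcal C(\mathbf G)$, then $\mathbf G$ is locally Finsler-metrizable. (ii) Let $U\subseteq M$ and $\mathcal C\subseteq TM$. If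 $R=0$ on $\mathcal C$ and $\tau\neq0$ at some point of $\mathcal C$, then $\mathbf G$ is not Finsler-metrizable over $U$ on $\mathcal C$. (In particular, if $M\ne\emptyset$, $R=0$ and $\tau$ vanishes nowhere on $\mathcal C(\mathbf G)$, then $\mathbf G$ is not Finsler-metrizable on any conical region over $M$, nor over any nonempty subset of $M$.) (iii) Let $U\subseteq M$ and $\mathcal C\subseteq TM$. If at some point of $\mathcal C$ one has $R\neq0$ and, in some local coordinates and for some indices $i,j$, $$\Big(\frac{\tau_i}{R}\Big)_{;j}\neq0\quad\text{or}\quad\Big(\frac{\tau_i}{R}\Big)_{.j}\neq\Big(\frac{\tau_j}{R}\Big)_{.i},$$ then $\mathbf G$ is not Finsler-metrizable over $U$ on $\mathcal C$. -/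

import Mathlib

open scoped Manifold ContDiff

noncomputable section

namespace SprayGeometry

/-! ### Coordinate calculus in `ℝⁿ × ℝⁿ` (position `x = p.1`, velocity `y = p.2`) -/

/-- `∂f/∂xᵏ`. -/
def dx {n : ℕ} (k : Fin n)
    (f : EuclideanSpace ℝ (Fin n) × EuclideanSpace ℝ (Fin n) → ℝ)
    (p : EuclideanSpace ℝ (Fin n) × EuclideanSpace ℝ (Fin n)) : ℝ :=
  fderiv ℝ f p (EuclideanSpace.single k 1, 0)

/-- `∂f/∂yᵏ`. -/
def dy {n : ℕ} (k : Fin n)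
    (f : EuclideanSpace ℝ (Fin n) × EuclideanSpace ℝ (Fin n) → ℝ)
    (p : EuclideanSpace ℝ (Fin n) × EuclideanSpace ℝ (Fin n)) : ℝ :=
  fderiv ℝ f p (0, EuclideanSpace.single k 1)

/-- The Riemann curvature `Rⁱₖ` of local spray coefficients `Gⁱ`:
`2 ∂ₖGⁱ - yʲ ∂ⱼ∂̇ₖGⁱ + 2 Gʲ ∂̇ⱼ∂̇ₖGⁱ - (∂̇ⱼGⁱ)(∂̇ₖGʲ)`. -/
def riemannCurvature {n : ℕ}
    (G : Fin n → EuclideanSpace ℝ (Fin n) × EuclideanSpace ℝ (Fin n) → ℝ) (i k : Fin n)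
    (p : EuclideanSpace ℝ (Fin n) × EuclideanSpace ℝ (Fin n)) : ℝ :=
  2 * dx k (G i) p - ∑ j, p.2 j * dx j (dy k (G i)) p
    + 2 * ∑ j, G j p * dy j (dy k (G i)) p - ∑ j, dy j (G i) p * dy k (G j) p

/-- Horizontal Berwald derivative of a covector `T = Tᵢ dxⁱ`:
`T_{i;j} = (∂ⱼ - Gʳⱼ ∂̇ᵣ) Tᵢ - Tᵣ Gʳᵢⱼ`, where `Gʳⱼ = ∂̇ⱼGʳ` and `Gʳᵢⱼ = ∂̇ⱼ∂̇ᵢGʳ`. -/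
def horizontalDeriv {n : ℕ}
    (G T : Fin n → EuclideanSpace ℝ (Fin n) × EuclideanSpace ℝ (Fin n) → ℝ) (i j : Fin n)
    (p : EuclideanSpace ℝ (Fin n) × EuclideanSpace ℝ (Fin n)) : ℝ :=
  dx j (T i) p - ∑ r, dy j (G r) p * dy r (T i) p - ∑ r, T r p * dy j (dy i (G r)) p

/-- Vertical derivative of a covector: `T_{i.j} = ∂̇ⱼ Tᵢ`. -/
def verticalDeriv {n : ℕ}
    (T : Fin n → EuclideanSpace ℝ (Fin n) × EuclideanSpace ℝ (Fin n) → ℝ) (i j : Fin n)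
    (p : EuclideanSpace ℝ (Fin n) × EuclideanSpace ℝ (Fin n)) : ℝ :=
  dy j (T i) p

/-- The fundamental tensor `gᵢⱼ = ½ ∂²L/∂yⁱ∂yʲ`. -/
def fundamentalTensor {n : ℕ}
    (L : EuclideanSpace ℝ (Fin n) × EuclideanSpace ℝ (Fin n) → ℝ)
    (p : EuclideanSpace ℝ (Fin n) × EuclideanSpace ℝ (Fin n)) : Matrix (Fin n) (Fin n) ℝ :=
  Matrix.of fun i j => (1 / 2 : ℝ) * dy j (dy i L) p

/-- The spray coefficients induced by `L`: `Gⁱ = ¼ gⁱˡ (L_{xᵏyˡ} yᵏ - L_{xˡ})`. -/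
def inducedCoeff {n : ℕ}
    (L : EuclideanSpace ℝ (Fin n) × EuclideanSpace ℝ (Fin n) → ℝ) (i : Fin n)
    (p : EuclideanSpace ℝ (Fin n) × EuclideanSpace ℝ (Fin n)) : ℝ :=
  (1 / 4 : ℝ) * ∑ l, (fundamentalTensor L p)⁻¹ i l *
    ((∑ k, dy l (dx k L) p * p.2 k) - dx l L p)

/-! ### Charts of the tangent bundle and conical regions -/

section Manifold

variable {n : ℕ} {M : Type*} [TopologicalSpace M] [ChartedSpace (EuclideanSpace ℝ (Fin n)) M]

/-- The coordinates `(x, y)` on the tangent bundle associated with a chart `φ` of `M`. -/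
def tangentChart (φ : OpenPartialHomeomorph M (EuclideanSpace ℝ (Fin n)))
    (v : TangentBundle (𝓡 n) M) : EuclideanSpace ℝ (Fin n) × EuclideanSpace ℝ (Fin n) :=
  (φ v.proj, mfderiv (𝓡 n) (𝓡 n) φ v.proj v.snd)

/-- The tangent vector `yⁱ ∂/∂xⁱ` at `φ⁻¹ x`, as a function of the coordinates `(x, y)`. -/
def tangentChartInv (φ : OpenPartialHomeomorph M (EuclideanSpace ℝ (Fin n)))
    (p : EuclideanSpace ℝ (Fin n) × EuclideanSpace ℝ (Fin n)) : TangentBundle (𝓡 n) M :=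
  ⟨φ.symm p.1, mfderiv (𝓡 n) (𝓡 n) φ.symm p.1 p.2⟩

/-- The part of `C ⊆ TM` over the domain of the chart `φ`, in coordinates. -/
def coordDomain (φ : OpenPartialHomeomorph M (EuclideanSpace ℝ (Fin n)))
    (C : Set (TangentBundle (𝓡 n) M)) :
    Set (EuclideanSpace ℝ (Fin n) × EuclideanSpace ℝ (Fin n)) :=
  {p | p.1 ∈ φ.target ∧ tangentChartInv φ p ∈ C}

/-- Components in the chart `φ` of a covector field `τ` along the tangent bundle:
`τₖ(x, y) = τ_{(x, y)}(∂/∂xᵏ)`. -/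
def covectorComponent (φ : OpenPartialHomeomorph M (EuclideanSpace ℝ (Fin n)))
    (τ : ∀ v : TangentBundle (𝓡 n) M, TangentSpace (𝓡 n) v.proj →L[ℝ] ℝ) (k : Fin n)
    (p : EuclideanSpace ℝ (Fin n) × EuclideanSpace ℝ (Fin n)) : ℝ :=
  τ (tangentChartInv φ p)
    (mfderiv (𝓡 n) (𝓡 n) φ.symm p.1 (EuclideanSpace.single k (1 : ℝ)))

variable [IsManifold (𝓡 n) ∞ M]

/-- `C` is a conical region of `TU ∖ 0`: an open set of nonzero tangent vectors, stable under
multiplication by positive numbers, with a nonempty fibre exactly over the points of `U`. -/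
structure IsConicalRegion (U : Set M) (C : Set (TangentBundle (𝓡 n) M)) : Prop where
  isOpen : IsOpen C
  ne_zero : ∀ v ∈ C, v.snd ≠ 0
  smul_mem : ∀ v ∈ C, ∀ c : ℝ, 0 < c → (⟨v.proj, c • v.snd⟩ : TangentBundle (𝓡 n) M) ∈ C
  proj_image : (fun v : TangentBundle (𝓡 n) M => v.proj) '' C = U

/-- The components `(ẋ, ẏ)`, in the coordinates attached to the chart `φ`, of a vector field on
the tangent bundle. -/
def fieldInChart (V : ∀ v : TangentBundle (𝓡 n) M, TangentSpace (𝓡 n).tangent v)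
    (φ : OpenPartialHomeomorph M (EuclideanSpace ℝ (Fin n)))
    (p : EuclideanSpace ℝ (Fin n) × EuclideanSpace ℝ (Fin n)) :
    EuclideanSpace ℝ (Fin n) × EuclideanSpace ℝ (Fin n) :=
  mfderiv (𝓡 n).tangent 𝓘(ℝ, EuclideanSpace ℝ (Fin n) × EuclideanSpace ℝ (Fin n))
    (tangentChart φ) (tangentChartInv φ p) (V (tangentChartInv φ p))

/-- The coefficients `Gⁱ` in the expression `yⁱ ∂/∂xⁱ - 2 Gⁱ ∂/∂yⁱ`. -/
def fieldCoeff (V : ∀ v : TangentBundle (𝓡 n) M, TangentSpace (𝓡 n).tangent v)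
    (φ : OpenPartialHomeomorph M (EuclideanSpace ℝ (Fin n))) (i : Fin n)
    (p : EuclideanSpace ℝ (Fin n) × EuclideanSpace ℝ (Fin n)) : ℝ :=
  (-1 / 2 : ℝ) * (fieldInChart V φ p).2 i

variable (n M) in
/-- A spray on `M`: a smooth vector field on a conical region of `TM ∖ 0` which in every local
coordinate system is `yⁱ ∂/∂xⁱ - 2 Gⁱ ∂/∂yⁱ` with `Gⁱ(x, cy) = c² Gⁱ(x, y)` for `c > 0`. -/
structure Spray where
  region : Set (TangentBundle (𝓡 n) M)
  isConicalRegion : IsConicalRegion Set.univ region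
  field : ∀ v : TangentBundle (𝓡 n) M, TangentSpace (𝓡 n).tangent v
  smooth : ContMDiffOn (𝓡 n).tangent (𝓡 n).tangent.tangent ∞
    (fun v => (⟨v, field v⟩ : TangentBundle (𝓡 n).tangent (TangentBundle (𝓡 n) M))) region
  second_order : ∀ φ ∈ IsManifold.maximalAtlas (𝓡 n) ∞ M, ∀ p ∈ coordDomain φ region,
    (fieldInChart field φ p).1 = p.2
  homogeneous : ∀ φ ∈ IsManifold.maximalAtlas (𝓡 n) ∞ M, ∀ p ∈ coordDomain φ region,
    ∀ i : Fin n, ∀ c : ℝ, 0 < c →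
      fieldCoeff field φ i (p.1, c • p.2) = c ^ 2 * fieldCoeff field φ i p

/-- The local spray coefficients `Gⁱ` of a spray in the chart `φ`. -/
def Spray.coeff (G : Spray n M) (φ : OpenPartialHomeomorph M (EuclideanSpace ℝ (Fin n)))
    (i : Fin n) (p : EuclideanSpace ℝ (Fin n) × EuclideanSpace ℝ (Fin n)) : ℝ :=
  fieldCoeff G.field φ i p

/-- `G` is of scalar curvature with data `R`, `τ`: these are smooth on the region of `G`, positively
homogeneous of degree two and one respectively, and `Rⁱₖ = R δⁱₖ - τₖ yⁱ` in every chart. -/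
structure Spray.IsOfScalarCurvature (G : Spray n M) (R : TangentBundle (𝓡 n) M → ℝ)
    (τ : ∀ v : TangentBundle (𝓡 n) M, TangentSpace (𝓡 n) v.proj →L[ℝ] ℝ) : Prop where
  smooth_R : ContMDiffOn (𝓡 n).tangent 𝓘(ℝ, ℝ) ∞ R G.region
  smooth_τ : ∀ φ ∈ IsManifold.maximalAtlas (𝓡 n) ∞ M, ∀ k : Fin n,
    ContDiffOn ℝ ∞ (covectorComponent φ τ k) (coordDomain φ G.region)
  homogeneous_R : ∀ v ∈ G.region, ∀ c : ℝ, 0 < c → R ⟨v.proj, c • v.snd⟩ = c ^ 2 * R v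
  homogeneous_τ : ∀ v ∈ G.region, ∀ c : ℝ, 0 < c → τ ⟨v.proj, c • v.snd⟩ = c • τ v
  curvature_eq : ∀ φ ∈ IsManifold.maximalAtlas (𝓡 n) ∞ M, ∀ p ∈ coordDomain φ G.region,
    ∀ i k : Fin n, riemannCurvature (G.coeff φ) i k p =
      R (tangentChartInv φ p) * (if i = k then 1 else 0) - covectorComponent φ τ k p * p.2 i

/-- A (possibly singular) Finsler metric over `U`, defined on the conical region `C`: a smooth
function `L`, positively homogeneous of degree two, with nondegenerate fundamental tensor, and
nonzero as a function on each fibre. It may vanish at single vectors and may be negative. -/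
structure IsFinslerMetric (U : Set M) (C : Set (TangentBundle (𝓡 n) M))
    (L : TangentBundle (𝓡 n) M → ℝ) : Prop where
  isConicalRegion : IsConicalRegion U C
  smooth : ContMDiffOn (𝓡 n).tangent 𝓘(ℝ, ℝ) ∞ L C
  homogeneous : ∀ v ∈ C, ∀ c : ℝ, 0 < c → L ⟨v.proj, c • v.snd⟩ = c ^ 2 * L v
  nondegenerate : ∀ φ ∈ IsManifold.maximalAtlas (𝓡 n) ∞ M, ∀ p ∈ coordDomain φ C,
    (fundamentalTensor (fun q => L (tangentChartInv φ q)) p).det ≠ 0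
  nontrivial : ∀ x ∈ U, ∃ v ∈ C, v.proj = x ∧ L v ≠ 0

/-- `L` induces the spray `G` on `C`: in every chart the coefficients of `G` are those of `L`. -/
def Spray.IsInducedBy (G : Spray n M) (C : Set (TangentBundle (𝓡 n) M))
    (L : TangentBundle (𝓡 n) M → ℝ) : Prop :=
  ∀ φ ∈ IsManifold.maximalAtlas (𝓡 n) ∞ M, ∀ p ∈ coordDomain φ C, ∀ i : Fin n,
    G.coeff φ i p = inducedCoeff (fun q => L (tangentChartInv φ q)) i p

/-- `G` is Finsler-metrizable over `U` on the conical region `C` (contained in the region of `G`).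
The case `U = univ` is global metrizability. -/
def Spray.IsFinslerMetrizableOn (G : Spray n M) (U : Set M)
    (C : Set (TangentBundle (𝓡 n) M)) : Prop :=
  C ⊆ G.region ∧ ∃ L : TangentBundle (𝓡 n) M → ℝ, IsFinslerMetric U C L ∧ G.IsInducedBy C L

/-- `G` is locally Finsler-metrizable: each point has an open neighbourhood `U` such that `G` is
induced by a Finsler metric defined on some conical region over `U`. -/
def Spray.IsLocallyFinslerMetrizable (G : Spray n M) : Prop :=
  ∀ x : M, ∃ U : Set M, IsOpen U ∧ x ∈ U ∧
    ∃ C : Set (TangentBundle (𝓡 n) M), G.IsFinslerMetrizableOn U C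

/-- The components of the covector `τ / R` in the chart `φ`. -/
def quotientComponent (R : TangentBundle (𝓡 n) M → ℝ)
    (τ : ∀ v : TangentBundle (𝓡 n) M, TangentSpace (𝓡 n) v.proj →L[ℝ] ℝ)
    (φ : OpenPartialHomeomorph M (EuclideanSpace ℝ (Fin n))) (i : Fin n)
    (p : EuclideanSpace ℝ (Fin n) × EuclideanSpace ℝ (Fin n)) : ℝ :=
  covectorComponent φ τ i p / R (tangentChartInv φ p)

end Manifold

end SprayGeometry

end

noncomputable section

namespace SprayGeometry

/-! ### Smoothness of superposition operators -/

section Superposition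

open Topology Metric

variable {K : Type*} [TopologicalSpace K] [CompactSpace K]

/-! For a function `L` of degree 2 and a spray of degree 2, the Euler-Lagrange equations say exactly
that `L` is killed by all horizontal vectors `(h, -∂̇_h 𝒢)` (`fderiv_horizontal_eq_zero`,
`isEulerLagrange_of_horizontal`). When the fundamental tensor is invertible, they also say that `L`
induces the spray (`isEulerLagrange_iff`). Metrizability thus amounts to finding a nondegenerate,
horizontally constant `L`.

Obstructions. Such an `L` is constant along the spray and along horizontal fields, hence also along
the vertical part of their brackets, which is the Riemann curvature: `Rⁱₖ ∂̇ᵢL = 0`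
(`fderiv_riemannVector_eq_zero`). For `Rⁱₖ = R δⁱₖ - τₖ yⁱ`, Euler's relation turns this into `R
∂̇ₖL = 2 τₖ L` (`scalarCurvature_mul_dy`). If `R = 0`, then `L` vanishes on the open set where `τₖ ≠
0`, which nondegeneracy forbids. Where `R ≠ 0`, the covector `τ / R` is half the vertical
logarithmic derivative of `L`, so its vertical derivative is symmetric and its horizontal derivative
vanishes. Zeros of `L` do no harm: the identities are proved after multiplication by `L`, which
vanishes on no open set (`eq_zero_of_mul_eventually_eq_zero`).

Existence. If the Riemann curvature vanishes, so does the curvature of the nonlinear connection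
(`connection_curvature_comm`). Parallel transport along straight rays to the fibre over `x₀` then
gives a horizontally constant map `Y` (`exists_horizontally_constant`). The function `‖Y‖²` is
horizontally constant and restricts to `‖y‖²` over `x₀`, so it is nondegenerate nearby; rescaling
extends it to a cone (`exists_local_metric`), and `isFinslerMetrizableOn_of_chart` carries the
result to the manifold.

Smooth dependence of transport on its data comes from the inverse function theorem in `C([0,1], E)`,
applied to the integral form of the equation. This requires superposition operators to be smooth
(`contDiff_superposition`). -/

/-- The pointwise pairing of a continuous family of continuous linear maps with a continuous
function. -/
def pointwiseApply (K : Type*) [TopologicalSpace K] [CompactSpace K]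
    (P Q : Type*) [NormedAddCommGroup P] [NormedSpace ℝ P]
    [NormedAddCommGroup Q] [NormedSpace ℝ Q] :
    C(K, P →L[ℝ] Q) →L[ℝ] C(K, P) →L[ℝ] C(K, Q) :=
  LinearMap.mkContinuous₂
    (LinearMap.mk₂ ℝ (fun (A : C(K, P →L[ℝ] Q)) (v : C(K, P)) =>
        (⟨fun t => A t (v t), by fun_prop⟩ : C(K, Q)))
      (fun _ _ _ => by ext; simp) (fun _ _ _ => by ext; simp)
      (fun _ _ _ => by ext; simp) (fun _ _ _ => by ext; simp)) 1
    (fun A v => by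
      refine (ContinuousMap.norm_le _ (by positivity)).2 fun t => ?_
      rw [one_mul]
      exact ((A t).le_opNorm _).trans
        (mul_le_mul (A.norm_coe_le_norm t) (v.norm_coe_le_norm t) (norm_nonneg _)
          ((norm_nonneg (A t)).trans (A.norm_coe_le_norm t))))

@[simp]
theorem pointwiseApply_apply {P Q : Type*} [NormedAddCommGroup P] [NormedSpace ℝ P]
    [NormedAddCommGroup Q] [NormedSpace ℝ Q] (A : C(K, P →L[ℝ] Q)) (v : C(K, P)) (t : K) :
    pointwiseApply K P Q A v t = A t (v t) := rfl

/-- Postcomposition with `F'` is continuous for the sup norm because `K` is compact. This makes the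
modulus of continuity of `F'` along `u` uniform in `t`, and the mean value inequality at each `t`
then gives the little-o estimate. -/
theorem hasFDerivAt_superposition {P Q : Type*} [NormedAddCommGroup P] [NormedSpace ℝ P]
    [NormedAddCommGroup Q] [NormedSpace ℝ Q] {F : C(P, Q)} {F' : C(P, P →L[ℝ] Q)}
    (hF : ∀ p, HasFDerivAt F (F' p) p) (u : C(K, P)) :
    HasFDerivAt (fun w : C(K, P) => F.comp w) (pointwiseApply K P Q (F'.comp u)) u := by
  rw [hasFDerivAt_iff_isLittleO_nhds_zero, Asymptotics.isLittleO_iff]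
  intro ε hε
  have hc : ContinuousAt (fun w : C(K, P) => F'.comp w) u :=
    (ContinuousMap.continuous_postcomp F').continuousAt
  obtain ⟨δ, hδ, hball⟩ := (Metric.continuousAt_iff (α := C(K, P)) (β := C(K, P →L[ℝ] Q))).1 hc ε hε
  filter_upwards [Metric.ball_mem_nhds (0 : C(K, P)) hδ] with v hv
  refine (ContinuousMap.norm_le _ (by positivity)).2 fun t => ?_
  have hv' : ‖v‖ < δ := by simpa using hv
  have hb : ∀ z ∈ ball (u t) δ, ‖F' z - F' (u t)‖ ≤ ε := by
    intro z hz
    -- A point `z` near `u t` is the value at `t` of `u` shifted by a constant, so continuity in the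
    -- function space bounds `F'` at `z`.
    have h1 : dist (u + ContinuousMap.const K (z - u t)) u < δ := by
      rw [dist_eq_norm, add_sub_cancel_left]
      refine lt_of_le_of_lt ((ContinuousMap.norm_le _ (norm_nonneg (z - u t))).2 fun s => ?_)
        (mem_ball_iff_norm.1 hz)
      simp
    have h2 := (ContinuousMap.norm_coe_le_norm
      (F'.comp (u + ContinuousMap.const K (z - u t)) - F'.comp u) t).trans
      ((dist_eq_norm _ _).symm.trans_le (hball h1).le)
    simpa using h2
  have hmv := (convex_ball (u t) δ).norm_image_sub_le_of_norm_hasFDerivWithin_le'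
    (f := F) (f' := F') (φ := F' (u t)) (C := ε)
    (fun z _ => (hF z).hasFDerivWithinAt) hb (mem_ball_self hδ)
    (y := u t + v t) (by
      rw [mem_ball_iff_norm, add_sub_cancel_left]
      exact (v.norm_coe_le_norm t).trans_lt hv')
  have : ‖F (u t + v t) - F (u t) - F' (u t) (v t)‖ ≤ ε * ‖v‖ := by
    refine (by simpa using hmv : _ ≤ ε * ‖v t‖).trans ?_
    exact mul_le_mul_of_nonneg_left (v.norm_coe_le_norm t) hε.le
  simpa using this

/-- The derivative is again a superposition operator, for `fderiv ℝ F`, followed by the bounded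
bilinear pairing. The induction therefore ranges over all targets `Q`, as it passes from `Q` to `P
→L[ℝ] Q`; keeping both spaces in `Type` makes this possible without changing universe. -/
theorem contDiff_superposition_nat {P : Type} [NormedAddCommGroup P] [NormedSpace ℝ P] (m : ℕ) :
    ∀ {Q : Type} [NormedAddCommGroup Q] [NormedSpace ℝ Q] (F : C(P, Q)), ContDiff ℝ m F →
      ContDiff ℝ m (fun w : C(K, P) => F.comp w) := by
  induction m with
  | zero =>
    intro Q _ _ F _
    exact contDiff_zero.2 (ContinuousMap.continuous_postcomp F)
  | succ m ih =>
    intro Q _ _ F hF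
    have hF' : ContDiff ℝ m (fderiv ℝ F) := hF.fderiv_right (by norm_cast)
    have hd : ∀ p, HasFDerivAt F ((⟨fderiv ℝ F, hF'.continuous⟩ : C(P, P →L[ℝ] Q)) p) p :=
      fun p => ((hF.differentiable (by norm_cast)) p).hasFDerivAt
    rw [Nat.cast_succ]
    refine contDiff_succ_iff_hasFDerivAt.2 ⟨_, ?_, fun u => hasFDerivAt_superposition hd u⟩
    exact (pointwiseApply K P Q).contDiff.comp (ih ⟨fderiv ℝ F, hF'.continuous⟩ hF')

/-- The superposition operator `w ↦ F ∘ w` associated with a smooth map `F` is smooth on spaces of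
continuous functions. -/
theorem contDiff_superposition {P Q : Type} [NormedAddCommGroup P] [NormedSpace ℝ P]
    [NormedAddCommGroup Q] [NormedSpace ℝ Q] (F : C(P, Q)) (hF : ContDiff ℝ ∞ F) :
    ContDiff ℝ ∞ (fun w : C(K, P) => F.comp w) :=
  contDiff_infty.2 fun m => contDiff_superposition_nat m F (contDiff_infty.1 hF m)

end Superposition

/-! ### Parallel transport of a nonlinear connection along rays -/

section Transport

open Topology Set unitInterval

variable {E : Type} [NormedAddCommGroup E] [NormedSpace ℝ E]

/-- The primitive `t ↦ ∫₀ᵗ u` of a continuous function on the unit interval. -/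
def primitive (E : Type) [NormedAddCommGroup E] [NormedSpace ℝ E] : C(I, E) →L[ℝ] C(I, E) :=
  have hi : ∀ (u : C(I, E)) (a b : ℝ),
      IntervalIntegrable (IccExtend zero_le_one u) MeasureTheory.volume a b :=
    fun u a b => (u.continuous.Icc_extend' (h := zero_le_one)).intervalIntegrable a b
  LinearMap.mkContinuous
    { toFun := fun u => ⟨fun t => ∫ s in (0 : ℝ)..t, IccExtend zero_le_one u s,
        (intervalIntegral.continuous_primitive (hi u) 0).comp continuous_subtype_val⟩
      map_add' := fun u v => by
        ext t
        exact intervalIntegral.integral_add (hi u 0 t) (hi v 0 t)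
      map_smul' := fun c u => by
        ext t
        exact intervalIntegral.integral_smul c _ } 1
    (fun u => by
      refine (ContinuousMap.norm_le _ (by positivity)).2 fun t => ?_
      refine (intervalIntegral.norm_integral_le_of_norm_le_const (C := ‖u‖)
        fun s _ => u.norm_coe_le_norm _).trans ?_
      rw [one_mul, sub_zero, abs_of_nonneg t.2.1]
      exact mul_le_of_le_one_right (norm_nonneg _) t.2.2)

theorem hasDerivAt_primitive [CompleteSpace E] (u : C(I, E)) (t : ℝ) :
    HasDerivAt (fun t : ℝ => ∫ s in (0 : ℝ)..t, IccExtend zero_le_one u s)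
      (IccExtend zero_le_one u t) t := by
  have hc : Continuous (IccExtend zero_le_one u) := u.continuous.Icc_extend'
  exact intervalIntegral.integral_hasDerivAt_right (hc.intervalIntegrable _ _)
    (hc.stronglyMeasurableAtFilter _ _) hc.continuousAt

/-- The curve `t ↦ ((1 - t) z, u t, z)` over the ray from `z` to the origin. -/
def rayLift (E : Type) [NormedAddCommGroup E] [NormedSpace ℝ E] :
    E × C(I, E) →L[ℝ] C(I, E × E × E) :=
  LinearMap.mkContinuous
    { toFun := fun q => ⟨fun t => ((1 - (t : ℝ)) • q.1, q.2 t, q.1), by fun_prop⟩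
      map_add' := fun p q => by ext t <;> simp
      map_smul' := fun c q => by ext t <;> simp [smul_comm c] } 1
    (fun q => by
      refine (ContinuousMap.norm_le _ (by positivity)).2 fun t => ?_
      rw [one_mul]
      refine max_le ?_ (max_le ?_ ?_)
      · refine (norm_smul_le _ _).trans ?_
        rw [Real.norm_of_nonneg (by linarith [t.2.2])]
        exact (mul_le_of_le_one_left (norm_nonneg _) (by linarith [t.2.1])).trans
          (norm_fst_le q)
      · exact (q.2.norm_coe_le_norm t).trans (norm_snd_le q)
      · exact norm_fst_le q)

@[simp]
theorem rayLift_apply (q : E × C(I, E)) (t : I) :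
    rayLift E q t = ((1 - (t : ℝ)) • q.1, q.2 t, q.1) := rfl

/-- The right hand side `(a, b, c) ↦ N (x₀ + a, b) c` of the equation of parallel transport. -/
def transportField (N : E × E → E →L[ℝ] E) (x₀ : E) (q : E × E × E) : E :=
  N (x₀ + q.1, q.2.1) q.2.2

theorem contDiff_transportField {N : E × E → E →L[ℝ] E} (hN : ContDiff ℝ ∞ N) (x₀ : E) :
    ContDiff ℝ ∞ (transportField N x₀) := by
  unfold transportField
  fun_prop

theorem fderiv_transportField {N : E × E → E →L[ℝ] E} (hN : ContDiff ℝ ∞ N) (x₀ : E)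
    (q v : E × E × E) :
    fderiv ℝ (transportField N x₀) q v =
      fderiv ℝ N (x₀ + q.1, q.2.1) (v.1, v.2.1) q.2.2 + N (x₀ + q.1, q.2.1) v.2.2 := by
  have h1 : HasFDerivAt (fun q : E × E × E => (x₀ + q.1, q.2.1))
      ((ContinuousLinearMap.fst ℝ E (E × E)).prod
        ((ContinuousLinearMap.fst ℝ E E).comp (ContinuousLinearMap.snd ℝ E (E × E)))) q :=
    ((hasFDerivAt_fst (p := q)).const_add x₀).prodMk (hasFDerivAt_fst.comp q hasFDerivAt_snd)
  have h2 : HasFDerivAt (fun q : E × E × E => q.2.2)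
      ((ContinuousLinearMap.snd ℝ E E).comp (ContinuousLinearMap.snd ℝ E (E × E))) q :=
    hasFDerivAt_snd.comp q hasFDerivAt_snd
  have h3 :=
    ((((hN.differentiable (by simp)) (x₀ + q.1, q.2.1)).hasFDerivAt).comp q h1).clm_apply h2
  have h4 : HasFDerivAt (transportField N x₀) _ q := h3
  rw [h4.fderiv]
  simp [add_comm]

/-- The equation of parallel transport along rays, in integrated form, reads
`transportMap N x₀ (z, u) = (z, const y)`. -/
def transportMap (N : E × E → E →L[ℝ] E) (hN : ContDiff ℝ ∞ N) (x₀ : E) (q : E × C(I, E)) :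
    E × C(I, E) :=
  (q.1, q.2 - primitive E
    (ContinuousMap.comp ⟨transportField N x₀, (contDiff_transportField hN x₀).continuous⟩
      (rayLift E q)))

theorem contDiff_transportMap (N : E × E → E →L[ℝ] E) (hN : ContDiff ℝ ∞ N) (x₀ : E) :
    ContDiff ℝ ∞ (transportMap N hN x₀) := by
  refine contDiff_fst.prodMk (contDiff_snd.sub ((primitive E).contDiff.comp ?_))
  exact (contDiff_superposition ⟨transportField N x₀, (contDiff_transportField hN x₀).continuous⟩
    (contDiff_transportField hN x₀)).comp (rayLift E).contDiff

/-- The derivative of the right hand side of the equation of parallel transport. -/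
def transportFieldDeriv (N : E × E → E →L[ℝ] E) (hN : ContDiff ℝ ∞ N) (x₀ : E) :
    C(E × E × E, E × E × E →L[ℝ] E) :=
  ⟨fderiv ℝ (transportField N x₀), (contDiff_transportField hN x₀).continuous_fderiv (by simp)⟩

theorem hasFDerivAt_transportMap (N : E × E → E →L[ℝ] E) (hN : ContDiff ℝ ∞ N) (x₀ : E)
    (q : E × C(I, E)) :
    HasFDerivAt (transportMap N hN x₀)
      ((ContinuousLinearMap.fst ℝ E C(I, E)).prod
        (ContinuousLinearMap.snd ℝ E C(I, E) - (primitive E).comp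
          ((pointwiseApply I (E × E × E) E ((transportFieldDeriv N hN x₀).comp
            (rayLift E q))).comp (rayLift E)))) q := by
  refine hasFDerivAt_fst.prodMk (hasFDerivAt_snd.sub ((primitive E).hasFDerivAt.comp q ?_))
  refine HasFDerivAt.comp (g := fun w : C(I, E × E × E) => ContinuousMap.comp
    ⟨transportField N x₀, (contDiff_transportField hN x₀).continuous⟩ w) q ?_
    (rayLift E).hasFDerivAt
  exact hasFDerivAt_superposition (F' := transportFieldDeriv N hN x₀)
    (fun p => (((contDiff_transportField hN x₀).differentiable (by simp)) p).hasFDerivAt) _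

/-- Inverse function theorem at `(0, const y₀)`, which `transportMap` fixes because transport along
a ray of length zero is constant. The solution `u p` is the second component of the local inverse at
`(p.1 - x₀, const p.2)`. The set `S` is the source of the local inverse and records where solutions
are unique. -/
theorem exists_transport [CompleteSpace E] (N : E × E → E →L[ℝ] E) (hN : ContDiff ℝ ∞ N)
    (x₀ y₀ : E) :
    ∃ (W : Set (E × E)) (S : Set (E × C(I, E))) (u : E × E → C(I, E)),
      IsOpen W ∧ (x₀, y₀) ∈ W ∧ IsOpen S ∧ ContDiffOn ℝ ∞ u W ∧
      u (x₀, y₀) = ContinuousMap.const I y₀ ∧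
      (∀ p ∈ W, (p.1 - x₀, u p) ∈ S ∧
        transportMap N hN x₀ (p.1 - x₀, u p) = (p.1 - x₀, ContinuousMap.const I p.2)) ∧
      ∀ p ∈ W, ∀ v, (p.1 - x₀, v) ∈ S →
        transportMap N hN x₀ (p.1 - x₀, v) = (p.1 - x₀, ContinuousMap.const I p.2) → v = u p := by
  set Φ := transportMap N hN x₀ with hΦ
  have hsm : ContDiff ℝ ∞ Φ := contDiff_transportMap N hN x₀
  set q₀ : E × C(I, E) := (0, ContinuousMap.const I y₀) with hq₀
  have hΦ₀ : Φ q₀ = q₀ := by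
    refine Prod.ext rfl ?_
    change q₀.2 - primitive E _ = q₀.2
    have : (ContinuousMap.comp ⟨transportField N x₀, (contDiff_transportField hN x₀).continuous⟩
      (rayLift E q₀) : C(I, E)) = 0 := by
      ext t
      simp [transportField, hq₀]
    rw [this, map_zero, sub_zero]
  -- At `q₀` the velocity of the ray is zero, so the derivative of `N` drops out. What remains is
  -- unipotent block triangular, hence invertible.
  let A : (E × C(I, E)) ≃L[ℝ] (E × C(I, E)) :=
    (ContinuousLinearEquiv.refl ℝ E).skewProd (ContinuousLinearEquiv.refl ℝ C(I, E))
      (-(primitive E).comp ((ContinuousLinearMap.const ℝ I).comp (N (x₀, y₀))))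
  have hA : HasFDerivAt Φ (A : (E × C(I, E)) →L[ℝ] (E × C(I, E))) q₀ := by
    convert hasFDerivAt_transportMap N hN x₀ q₀ using 1
    refine ContinuousLinearMap.ext fun v => Prod.ext rfl ?_
    change v.2 + -(primitive E _) = v.2 - primitive E _
    rw [← sub_eq_add_neg]
    congr 2
    ext t
    simp [transportFieldDeriv, fderiv_transportField hN, hq₀]
  let h := hsm.contDiffAt.toOpenPartialHomeomorph Φ hA (by simp)
  have hcoe : ∀ q, h q = Φ q := fun q => rfl
  -- Smoothness of the inverse away from `q₀` needs an invertible derivative there too, which is an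
  -- open condition.
  let D : Set (E × C(I, E)) := {q | fderiv ℝ Φ q ∈
    range ((↑) : ((E × C(I, E)) ≃L[ℝ] (E × C(I, E))) → _)}
  have hD : IsOpen D := ContinuousLinearEquiv.isOpen.preimage (hsm.continuous_fderiv (by simp))
  let j : E × E → E × C(I, E) := fun p => (p.1 - x₀, ContinuousMap.const I p.2)
  have hj : ContDiff ℝ ∞ j := (contDiff_fst.sub contDiff_const).prodMk
    ((ContinuousLinearMap.const ℝ I : E →L[ℝ] C(I, E)).contDiff.comp contDiff_snd)
  have hj₀ : j (x₀, y₀) = q₀ := by simp [j, hq₀]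
  have hsrc : q₀ ∈ h.source := hsm.contDiffAt.mem_toOpenPartialHomeomorph_source hA (by simp)
  have htgt : q₀ ∈ h.target := by
    have := h.map_source hsrc
    rwa [hcoe, hΦ₀] at this
  have hsymm : h.symm q₀ = q₀ := by
    have := h.left_inv hsrc
    rwa [hcoe, hΦ₀] at this
  have hfst : ∀ b ∈ h.target, (h.symm b).1 = b.1 := fun b hb => by
    have := congrArg Prod.fst (h.right_inv hb)
    rwa [hcoe] at this
  refine ⟨j ⁻¹' (h.target ∩ h.symm ⁻¹' D), h.source, fun p => (h.symm (j p)).2,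
    (h.symm.isOpen_inter_preimage hD).preimage hj.continuous, ?_, h.open_source, ?_, ?_, ?_, ?_⟩
  · refine ⟨by rwa [hj₀], ?_⟩
    rw [mem_preimage, hj₀, hsymm]
    exact ⟨A, hA.fderiv.symm⟩
  · rintro p ⟨hp, e, he⟩
    have hd : HasFDerivAt h (e : (E × C(I, E)) →L[ℝ] (E × C(I, E))) (h.symm (j p)) := by
      rw [he]
      exact ((hsm.differentiable (by simp)) _).hasFDerivAt
    have := h.contDiffAt_symm hp hd hsm.contDiffAt
    exact (contDiffAt_snd.comp p (this.comp p hj.contDiffAt)).contDiffWithinAt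
  · change (h.symm (j (x₀, y₀))).2 = _
    rw [hj₀, hsymm]
  · rintro p ⟨hp, -⟩
    have he : (p.1 - x₀, (h.symm (j p)).2) = h.symm (j p) := Prod.ext (hfst _ hp).symm rfl
    rw [he]
    exact ⟨h.map_target hp, h.right_inv hp⟩
  · rintro p ⟨hp, -⟩ v hv hv'
    have := h.left_inv hv
    rw [hcoe, hv'] at this
    exact (congrArg Prod.snd this).symm

end Transport

/-! ### Transport for a connection of zero curvature -/

section FlatTransport

open Topology Set unitInterval

variable {E : Type} [NormedAddCommGroup E] [NormedSpace ℝ E]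

theorem transportMap_eq_iff {N : E × E → E →L[ℝ] E} {hN : ContDiff ℝ ∞ N} {x₀ z y : E}
    {u : C(I, E)} :
    transportMap N hN x₀ (z, u) = (z, ContinuousMap.const I y) ↔
      u = ContinuousMap.const I y + primitive E (ContinuousMap.comp
        ⟨transportField N x₀, (contDiff_transportField hN x₀).continuous⟩ (rayLift E (z, u))) := by
  simp only [transportMap, Prod.mk.injEq, true_and]
  exact sub_eq_iff_eq_add

/-- Here `v` is the variation of the transported curve when its initial point `(x₀ + z, y)` moves in
the horizontal direction `(h, -N h)`. Flatness forces the variation to stay horizontal along the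
ray. At `t = 1` the base point is fixed at `x₀`, so a horizontal variation is zero. -/
theorem transport_variation_eq_zero [CompleteSpace E] {N : E × E → E →L[ℝ] E}
    (hN : ContDiff ℝ ∞ N) {x₀ z y h : E} {u v : C(I, E)}
    (hu : transportMap N hN x₀ (z, u) = (z, ContinuousMap.const I y))
    (hv : v - primitive E (pointwiseApply I (E × E × E) E
      ((transportFieldDeriv N hN x₀).comp (rayLift E (z, u))) (rayLift E (h, v))) =
        ContinuousMap.const I (-N (x₀ + z, y) h))
    (hcurv : ∀ t : I, ∀ a b, fderiv ℝ N (x₀ + (1 - (t : ℝ)) • z, u t)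
        (a, -N (x₀ + (1 - (t : ℝ)) • z, u t) a) b =
      fderiv ℝ N (x₀ + (1 - (t : ℝ)) • z, u t) (b, -N (x₀ + (1 - (t : ℝ)) • z, u t) b) a) :
    v 1 = 0 := by
  rw [transportMap_eq_iff] at hu
  rw [sub_eq_iff_eq_add] at hv
  set f : C(I, E) := ContinuousMap.comp
        ⟨transportField N x₀, (contDiff_transportField hN x₀).continuous⟩ (rayLift E (z, u)) with hf
  set g : C(I, E) := pointwiseApply I (E × E × E) E
      ((transportFieldDeriv N hN x₀).comp (rayLift E (z, u))) (rayLift E (h, v)) with hg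
  set k : E := -N (x₀ + z, y) h with hk
  let U : ℝ → E := fun t => y + ∫ s in (0 : ℝ)..t, IccExtend zero_le_one f s
  let V : ℝ → E := fun t => k + ∫ s in (0 : ℝ)..t, IccExtend zero_le_one g s
  have hUu : ∀ t : I, U t = u t := fun t => (DFunLike.congr_fun hu t).symm
  have hVv : ∀ t : I, V t = v t := fun t => (DFunLike.congr_fun hv t).symm
  have hU' : ∀ t, HasDerivAt U (IccExtend zero_le_one f t) t := fun t =>
    (hasDerivAt_primitive f t).const_add y
  have hV' : ∀ t, HasDerivAt V (IccExtend zero_le_one g t) t := fun t =>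
    (hasDerivAt_primitive g t).const_add k
  let c : ℝ → E := fun t => x₀ + (1 - t) • z
  have hc' : ∀ t, HasDerivAt c (-z) t := fun t => by
    simpa [c] using ((hasDerivAt_id t).const_sub 1).smul_const z
  -- The base point at time `t` moves by `(1 - t) h`, so `w` is the vertical part of the variation;
  -- it vanishes at `0` by the choice of `k`.
  let w : ℝ → E := fun t => V t + (1 - t) • N (c t, U t) h
  let w' : ℝ → E := fun t => IccExtend zero_le_one g t +
    ((1 - t) • fderiv ℝ N (c t, U t) (-z, IccExtend zero_le_one f t) h + (-1 : ℝ) • N (c t, U t) h)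
  have hw' : ∀ t, HasDerivAt w (w' t) t := fun t => by
    have h1 : HasDerivAt (fun t => N (c t, U t))
        (fderiv ℝ N (c t, U t) (-z, IccExtend zero_le_one f t)) t :=
      (((hN.differentiable (by simp)) (c t, U t)).hasFDerivAt).comp_hasDerivAt t
        ((hc' t).prodMk (hU' t))
    have h2 : HasDerivAt (fun t => N (c t, U t) h)
        (fderiv ℝ N (c t, U t) (-z, IccExtend zero_le_one f t) h) t := by
      simpa using h1.clm_apply (hasDerivAt_const t h)
    exact (hV' t).add (((hasDerivAt_id t).const_sub 1).smul h2)
  have hw0 : w 0 = 0 := by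
    simp [w, V, U, c, hk]
  have hcont : Continuous fun t => (c t, U t) := by
    refine Continuous.prodMk ?_ ?_
    · exact continuous_iff_continuousAt.2 fun t => (hc' t).continuousAt
    · exact continuous_iff_continuousAt.2 fun t => (hU' t).continuousAt
  obtain ⟨B, hB⟩ := (isCompact_Icc (a := (0 : ℝ)) (b := 1)).exists_bound_of_continuousOn
    ((hN.continuous_fderiv (by simp)).comp hcont).continuousOn
  have hval : ∀ t : I, w' t = fderiv ℝ N (c t, U t) (0, w t) z := by
    intro t
    have e1 : IccExtend zero_le_one f (t : ℝ) = N (c t, U t) z := by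
      rw [IccExtend_val, hUu]
      simp [hf, transportField, c]
    have e2 : IccExtend zero_le_one g (t : ℝ) =
        fderiv ℝ N (c t, U t) ((1 - (t : ℝ)) • h, V t) z + N (c t, U t) h := by
      rw [IccExtend_val, hUu, hVv]
      simp [hg, transportFieldDeriv, fderiv_transportField hN, c]
    -- The only use of flatness. It removes the inhomogeneous terms and leaves the linear equation
    -- `w' = (∂̇_w N) z`.
    have e3 : fderiv ℝ N (c t, U t) (-z, N (c t, U t) z) h =
        -fderiv ℝ N (c t, U t) (h, -N (c t, U t) h) z := by
      have := hcurv t z h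
      rw [← hUu t] at this
      change fderiv ℝ N (c t, U t) (z, -N (c t, U t) z) h = _ at this
      rw [show ((-z, N (c t, U t) z) : E × E) = -(z, -N (c t, U t) z) by simp, map_neg,
        neg_apply, this]
    have e4 : ((0 : E), w t) = ((1 - (t : ℝ)) • h, V t) +
        (-(1 - (t : ℝ))) • (h, -N (c t, U t) h) := by
      refine Prod.ext ?_ ?_ <;>
        simp only [w, Prod.fst_add, Prod.snd_add, Prod.smul_fst, Prod.smul_snd]
        <;> module
    simp only [w', e1, e2, e3]
    rw [e4, map_add, map_smul]
    simp only [add_apply, smul_apply]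
    module
  -- Uniqueness for this linear equation, with `B` a bound for the derivative of `N` along the
  -- compact curve.
  have hzero := eq_zero_of_abs_deriv_le_mul_abs_self_of_eq_zero_right (f := w) (f' := w')
    (K := B * ‖z‖) (a := 0) (b := 1)
    (fun t _ => (hw' t).continuousAt.continuousWithinAt)
    (fun t _ => (hw' t).hasDerivWithinAt) hw0
    (fun t ht => by
      rw [hval ⟨t, ht.1, ht.2.le⟩]
      refine (ContinuousLinearMap.le_opNorm _ _).trans ?_
      have h1 := (fderiv ℝ N (c t, U t)).le_opNorm (0, w t)
      have h2 : ‖((0 : E), w t)‖ = ‖w t‖ := by simp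
      have h3 := hB t ⟨ht.1, ht.2.le⟩
      rw [h2] at h1
      calc _ ≤ (‖fderiv ℝ N (c t, U t)‖ * ‖w t‖) * ‖z‖ := by gcongr
        _ ≤ (B * ‖w t‖) * ‖z‖ := by gcongr; exact h3
        _ = _ := by ring) 1 (by simp)
  have h1 : V (1 : I) = v 1 := hVv 1
  simpa [w, ← h1] using hzero

/-- A smooth nonlinear connection with vanishing curvature near `(x₀, y₀)` has, near this point,
a smooth map to the fibre over `x₀` which is constant along the horizontal distribution. -/
theorem exists_horizontally_constant [CompleteSpace E] {N : E × E → E →L[ℝ] E}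
    (hN : ContDiff ℝ ∞ N) {x₀ y₀ : E} {D : Set (E × E)} (hD : IsOpen D) (h₀ : (x₀, y₀) ∈ D)
    (hcurv : ∀ p ∈ D, ∀ a b, fderiv ℝ N p (a, -N p a) b = fderiv ℝ N p (b, -N p b) a)
    (hhom : ∀ p ∈ D, ∀ c : ℝ, 0 < c → (p.1, c • p.2) ∈ D → N (p.1, c • p.2) = c • N p) :
    ∃ (Y : E × E → E) (W : Set (E × E)), IsOpen W ∧ (x₀, y₀) ∈ W ∧ ContDiffOn ℝ ∞ Y W ∧
      (∀ y, (x₀, y) ∈ W → Y (x₀, y) = y) ∧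
      (∀ p ∈ W, ∀ h, fderiv ℝ Y p (h, -N p h) = 0) ∧
      ∀ᶠ q : ℝ × (E × E) in 𝓝 (1, (x₀, y₀)), Y (q.2.1, q.1 • q.2.2) = q.1 • Y q.2 := by
  obtain ⟨W, S, u, hW, hW₀, hS, hu, hu₀, hsol, huniq⟩ := exists_transport N hN x₀ y₀
  -- Curves lying entirely in `D`, where curvature and homogeneity are controlled. Compactness of
  -- the interval makes the condition open.
  let T : Set (E × C(I, E)) := {q | ∀ t : I, (x₀ + (1 - (t : ℝ)) • q.1, q.2 t) ∈ D}
  have hT : IsOpen T := by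
    have h1 : IsOpen {w : C(I, E × E × E) | MapsTo w univ {q | (x₀ + q.1, q.2.1) ∈ D}} :=
      ContinuousMap.isOpen_setOfPred_mapsTo isCompact_univ (hD.preimage (by fun_prop))
    have h2 := h1.preimage (rayLift E).continuous
    convert h2 using 1
    ext q
    simp [T, MapsTo]
  have hj : ContinuousOn (fun p : E × E => (p.1 - x₀, u p)) W :=
    (continuous_fst.sub continuous_const).continuousOn.prodMk hu.continuousOn
  have hj₀ : ((x₀, y₀).1 - x₀, u (x₀, y₀)) = (0, ContinuousMap.const I y₀) := by
    rw [hu₀]; simp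
  have hT₀ : ((0 : E), ContinuousMap.const I y₀) ∈ T := fun t => by simpa using h₀
  let ev : C(I, E) →L[ℝ] E := ContinuousMap.evalCLM ℝ (1 : I)
  refine ⟨fun p => u p 1, W ∩ (fun p : E × E => (p.1 - x₀, u p)) ⁻¹' T,
    hj.isOpen_inter_preimage hW hT, ⟨hW₀, ?_⟩, ?_, ?_, ?_, ?_⟩
  · rw [mem_preimage, hj₀]
    exact hT₀
  · exact (ev.contDiff.comp_contDiffOn hu).mono inter_subset_left
  · rintro y ⟨hy, -⟩
    have := transportMap_eq_iff.1 (hsol _ hy).2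
    have h2 := DFunLike.congr_fun this 1
    have h3 : (ContinuousMap.comp ⟨transportField N x₀, (contDiff_transportField hN x₀).continuous⟩
        (rayLift E ((x₀, y).1 - x₀, u (x₀, y))) : C(I, E)) = 0 := by
      ext t
      simp [transportField]
    rw [h3, map_zero, add_zero] at h2
    exact h2
  · rintro p ⟨hp, hpT⟩ h
    have hd : HasFDerivAt u (fderiv ℝ u p) p :=
      ((hu.contDiffAt (hW.mem_nhds hp)).differentiableAt (by simp)).hasFDerivAt
    have hdY : HasFDerivAt (fun p => u p 1) (ev.comp (fderiv ℝ u p)) p :=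
      ev.hasFDerivAt.comp p hd
    rw [hdY.fderiv]
    have hL := (hasFDerivAt_transportMap N hN x₀ (p.1 - x₀, u p)).comp p
      ((hasFDerivAt_fst.sub_const x₀).prodMk hd)
    have hR : HasFDerivAt (fun p : E × E => (p.1 - x₀, ContinuousMap.const I p.2)) _ p :=
      (hasFDerivAt_fst.sub_const x₀).prodMk
        ((ContinuousLinearMap.const ℝ I : E →L[ℝ] C(I, E)).hasFDerivAt.comp p hasFDerivAt_snd)
    have heq : (transportMap N hN x₀ ∘ fun p : E × E => (p.1 - x₀, u p)) =ᶠ[𝓝 p]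
        fun p => (p.1 - x₀, ContinuousMap.const I p.2) := by
      filter_upwards [hW.mem_nhds hp] with q hq using (hsol q hq).2
    -- Differentiating the integral equation in the direction `(h, -N p h)` gives the linearised
    -- equation required by `transport_variation_eq_zero`.
    have key := congrArg Prod.snd (DFunLike.congr_fun ((hR.congr_of_eventuallyEq heq).unique hL)
      (h, -N p h))
    refine transport_variation_eq_zero hN (hsol p hp).2 (v := fderiv ℝ u p (h, -N p h)) (h := h)
      ?_ ?_
    · rw [add_sub_cancel]
      exact key.symm
    · intro t a b
      exact hcurv _ (hpT t) a b
  · have hc1 : ContinuousAt (fun q : ℝ × (E × E) => (q.2.1, q.1 • q.2.2)) (1, (x₀, y₀)) := by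
      fun_prop
    have hjc : ContinuousAt (fun q : ℝ × (E × E) => (q.2.1 - x₀, u q.2)) (1, (x₀, y₀)) :=
      ContinuousAt.comp (f := Prod.snd) (g := fun p : E × E => (p.1 - x₀, u p))
        (hj.continuousAt (hW.mem_nhds hW₀)) continuousAt_snd
    have hjs : ContinuousAt (fun q : ℝ × (E × E) => (q.2.1 - x₀, q.1 • u q.2)) (1, (x₀, y₀)) :=
      (continuousAt_fst.comp hjc).prodMk (continuousAt_fst.smul (continuousAt_snd.comp hjc))
    have hval : ((1 : ℝ), (x₀, y₀)).2.1 - x₀ = 0 := sub_self x₀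
    have hS₀ : ((0 : E), ContinuousMap.const I y₀) ∈ S := hj₀ ▸ (hsol _ hW₀).1
    have a1 := hc1.preimage_mem_nhds (t := W) (by simpa using hW.mem_nhds hW₀)
    have a2 := continuousAt_snd.preimage_mem_nhds (x := ((1 : ℝ), (x₀, y₀))) (hW.mem_nhds hW₀)
    have a3 := hjc.preimage_mem_nhds (t := T)
      (by simp only [hu₀, sub_self]; exact hT.mem_nhds hT₀)
    have a4 := hjs.preimage_mem_nhds (t := T)
      (by simp only [hu₀, sub_self, one_smul]; exact hT.mem_nhds hT₀)
    have a5 := hjs.preimage_mem_nhds (t := S)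
      (by simp only [hu₀, sub_self, one_smul]; exact hS.mem_nhds hS₀)
    have a6 := continuousAt_fst.preimage_mem_nhds (x := ((1 : ℝ), (x₀, y₀)))
      (Ioi_mem_nhds zero_lt_one)
    filter_upwards [a1, a2, a3, a4, a5, a6] with q h1 h2 h3 h4 h5 h6
    obtain ⟨c, x, y⟩ := q
    have hcpos : 0 < c := h6
    have hsolq := transportMap_eq_iff.1 (hsol _ h2).2
    -- The multiple `c • u (x, y)` solves the transport equation with initial value `c • y`, since
    -- `N` has degree one. Uniqueness holds only inside `S`, so homogeneity is obtained for `c` near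
    -- 1.
    have := huniq (x, c • y) h1 (c • u (x, y)) h5 (by
      rw [transportMap_eq_iff]
      have hF : (ContinuousMap.comp
          ⟨transportField N x₀, (contDiff_transportField hN x₀).continuous⟩
            (rayLift E (x - x₀, c • u (x, y))) : C(I, E)) =
          c • ContinuousMap.comp
          ⟨transportField N x₀, (contDiff_transportField hN x₀).continuous⟩
            (rayLift E (x - x₀, u (x, y))) := by
        ext t
        have := hhom _ (h3 t) c hcpos (h4 t)
        simp only [ContinuousMap.comp_apply, ContinuousMap.coe_mk, rayLift_apply, transportField,
          ContinuousMap.smul_apply] at this ⊢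
        rw [this]
        rfl
      simp only [hF, map_smul]
      conv_lhs => rw [hsolq]
      rw [smul_add]
      rfl)
    exact (DFunLike.congr_fun this 1).symm

end FlatTransport

/-! ### Metrics and curvature in coordinate-free form -/

/-! ### Second derivatives and differentiated identities -/

section Calculus

open Topology

variable {X F : Type*} [NormedAddCommGroup X] [NormedSpace ℝ X]
  [NormedAddCommGroup F] [NormedSpace ℝ F]

theorem contDiffAt_fderiv {f : X → F} {p : X} (hf : ContDiffAt ℝ ∞ f p) :
    ContDiffAt ℝ ∞ (fderiv ℝ f) p :=
  hf.fderiv_right (by simp)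

theorem hasFDerivAt_fderiv {f : X → F} {p : X} (hf : ContDiffAt ℝ ∞ f p) :
    HasFDerivAt f (fderiv ℝ f p) p :=
  (hf.differentiableAt (by simp)).hasFDerivAt

theorem fderiv_fderiv_comm {f : X → F} {p : X} (hf : ContDiffAt ℝ ∞ f p) (v w : X) :
    fderiv ℝ (fderiv ℝ f) p v w = fderiv ℝ (fderiv ℝ f) p w v :=
  (hf.isSymmSndFDerivAt (by
    rw [minSmoothness_of_isRCLikeNormedField]
    exact WithTop.coe_le_coe.2 (le_top : (2 : ℕ∞) ≤ ⊤))).eq v w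

theorem hasFDerivAt_fderiv_apply {f : X → F} {p : X} (hf : ContDiffAt ℝ ∞ f p)
    {A : X → X} {A' : X →L[ℝ] X} (hA : HasFDerivAt A A' p) :
    HasFDerivAt (fun q => fderiv ℝ f q (A q))
      ((fderiv ℝ f p).comp A' + (fderiv ℝ (fderiv ℝ f) p).flip (A p)) p :=
  (hasFDerivAt_fderiv (contDiffAt_fderiv hf)).clm_apply hA

theorem fderiv_fderiv_apply_const {f : X → F} {p : X} (hf : ContDiffAt ℝ ∞ f p) (v w : X) :
    fderiv ℝ (fun q => fderiv ℝ f q w) p v = fderiv ℝ (fderiv ℝ f) p v w := by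
  rw [(hasFDerivAt_fderiv_apply hf (hasFDerivAt_const w p)).fderiv]
  simp

/-- Differentiating an identity `Df(q)(A q) = φ(q)`. -/
theorem fderiv_fderiv_add_eq {f : X → F} {p : X} (hf : ContDiffAt ℝ ∞ f p)
    {A : X → X} {A' : X →L[ℝ] X} (hA : HasFDerivAt A A' p) {φ : X → F} {φ' : X →L[ℝ] F}
    (hφ : HasFDerivAt φ φ' p) (h : ∀ᶠ q in 𝓝 p, fderiv ℝ f q (A q) = φ q) (v : X) :
    fderiv ℝ (fderiv ℝ f) p v (A p) + fderiv ℝ f p (A' v) = φ' v := by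
  have := (hasFDerivAt_fderiv_apply hf hA).unique (hφ.congr_of_eventuallyEq h)
  rw [← this]
  simp [add_comm]

end Calculus

/-! ### Euler-Lagrange equations, horizontal constancy and curvature -/

section Metrics

open Topology

variable {E : Type*} [NormedAddCommGroup E] [NormedSpace ℝ E]

/-- The vector field `(y, -2 𝒢)` of the spray with coefficients `𝒢`. -/
def sprayVector (𝒢 : E × E → E) (p : E × E) : E × E := (p.2, -(2 : ℝ) • 𝒢 p)

/-- The nonlinear connection `h ↦ ∂̇_h 𝒢` of the spray with coefficients `𝒢`. -/
def connection (𝒢 : E × E → E) (p : E × E) : E →L[ℝ] E :=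
  (fderiv ℝ 𝒢 p).comp (ContinuousLinearMap.inr ℝ E E)

@[simp]
theorem connection_apply (𝒢 : E × E → E) (p : E × E) (h : E) :
    connection 𝒢 p h = fderiv ℝ 𝒢 p (0, h) := rfl

/-- The Riemann curvature `h ↦ R(h)` of the spray with coefficients `𝒢`. -/
def riemannVector (𝒢 : E × E → E) (p : E × E) (h : E) : E :=
  (2 : ℝ) • fderiv ℝ 𝒢 p (h, 0) - fderiv ℝ (fderiv ℝ 𝒢) p (sprayVector 𝒢 p) (0, h)
    - fderiv ℝ 𝒢 p (0, fderiv ℝ 𝒢 p (0, h))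

theorem hasFDerivAt_sprayVector {𝒢 : E × E → E} {p : E × E} (h𝒢 : ContDiffAt ℝ ∞ 𝒢 p) :
    HasFDerivAt (sprayVector 𝒢) ((ContinuousLinearMap.snd ℝ E E).prod
      (-(2 : ℝ) • fderiv ℝ 𝒢 p)) p :=
  hasFDerivAt_snd.prodMk ((hasFDerivAt_fderiv h𝒢).const_smul _)

theorem hasFDerivAt_horizontal {𝒢 : E × E → E} {p : E × E} (h𝒢 : ContDiffAt ℝ ∞ 𝒢 p) (h : E) :
    HasFDerivAt (fun q => (h, -fderiv ℝ 𝒢 q (0, h)))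
      ((0 : E × E →L[ℝ] E).prod (-(fderiv ℝ (fderiv ℝ 𝒢) p).flip (0, h))) p := by
  have := hasFDerivAt_fderiv_apply h𝒢 (hasFDerivAt_const ((0 : E), h) p)
  rw [ContinuousLinearMap.comp_zero, zero_add] at this
  exact (hasFDerivAt_const h p).prodMk this.neg

variable {𝒢 : E × E → E} {L : E × E → ℝ} {Ω : Set (E × E)}

/-- The Euler-Lagrange equations of `L` are satisfied by the spray `𝒢`. -/
def IsEulerLagrange (𝒢 : E × E → E) (L : E × E → ℝ) (p : E × E) : Prop :=
  ∀ h : E, fderiv ℝ (fderiv ℝ L) p (sprayVector 𝒢 p) (0, h) = fderiv ℝ L p (h, 0)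

theorem prod_split (f : E × E →L[ℝ] ℝ) (a b : E) : f (a, b) = f (a, 0) + f (0, b) := by
  rw [← map_add]; simp

/-- Conservation of energy: differentiating Euler's relation along the spray and inserting the
Euler-Lagrange equation for `h = y` gives `DL(S) = 2 DL(S)`. -/
theorem fderiv_sprayVector_eq_zero (hΩ : IsOpen Ω) (hL : ContDiffOn ℝ ∞ L Ω)
    (hEuler : ∀ p ∈ Ω, fderiv ℝ L p (0, p.2) = 2 * L p)
    (hEL : ∀ p ∈ Ω, IsEulerLagrange 𝒢 L p) {p : E × E} (hp : p ∈ Ω) :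
    fderiv ℝ L p (sprayVector 𝒢 p) = 0 := by
  have hLp := hL.contDiffAt (hΩ.mem_nhds hp)
  have hA : HasFDerivAt (fun q : E × E => ((0 : E), q.2))
      ((0 : E × E →L[ℝ] E).prod (ContinuousLinearMap.snd ℝ E E)) p :=
    (hasFDerivAt_const 0 p).prodMk hasFDerivAt_snd
  have h1 := fderiv_fderiv_add_eq hLp hA ((hasFDerivAt_fderiv hLp).const_mul 2)
    (Filter.eventually_of_mem (hΩ.mem_nhds hp) hEuler) (sprayVector 𝒢 p)
  rw [hEL p hp p.2] at h1
  have h2 := prod_split (fderiv ℝ L p) (sprayVector 𝒢 p).1 (sprayVector 𝒢 p).2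
  simp only [ContinuousLinearMap.prod_apply, zero_apply,
    ContinuousLinearMap.coe_snd', smul_apply, smul_eq_mul] at h1
  have h3 : fderiv ℝ L p (sprayVector 𝒢 p) = fderiv ℝ L p (p.2, 0) +
    fderiv ℝ L p (0, (sprayVector 𝒢 p).2) := h2
  linarith

/-- Differentiate the conservation law `DL(S) = 0` in the vertical direction `h`. The Euler-Lagrange
equation replaces the second derivative by `DL(h, 0)`, and the sum is twice the horizontal
derivative. -/
theorem fderiv_horizontal_eq_zero (hΩ : IsOpen Ω) (hL : ContDiffOn ℝ ∞ L Ω)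
    (h𝒢 : ContDiffOn ℝ ∞ 𝒢 Ω)
    (hEuler : ∀ p ∈ Ω, fderiv ℝ L p (0, p.2) = 2 * L p)
    (hEL : ∀ p ∈ Ω, IsEulerLagrange 𝒢 L p) {p : E × E} (hp : p ∈ Ω) (h : E) :
    fderiv ℝ L p (h, -fderiv ℝ 𝒢 p (0, h)) = 0 := by
  have hLp := hL.contDiffAt (hΩ.mem_nhds hp)
  have h1 := fderiv_fderiv_add_eq hLp
    (hasFDerivAt_sprayVector (h𝒢.contDiffAt (hΩ.mem_nhds hp))) (hasFDerivAt_const (0 : ℝ) p)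
    (Filter.eventually_of_mem (hΩ.mem_nhds hp)
      fun q hq => fderiv_sprayVector_eq_zero hΩ hL hEuler hEL hq) (0, h)
  rw [fderiv_fderiv_comm hLp, hEL p hp h] at h1
  have h2 : ((ContinuousLinearMap.snd ℝ E E).prod (-(2 : ℝ) • fderiv ℝ 𝒢 p)) (0, h) =
      (h, -(2 : ℝ) • fderiv ℝ 𝒢 p (0, h)) := by simp
  have h3 : ((h, -fderiv ℝ 𝒢 p (0, h)) : E × E) =
      (1 / 2 : ℝ) • ((h, 0) + (h, -(2 : ℝ) • fderiv ℝ 𝒢 p (0, h))) := by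
    refine Prod.ext ?_ ?_ <;> simp only [Prod.fst_add, Prod.snd_add, Prod.smul_fst, Prod.smul_snd]
      <;> module
  rw [h2] at h1
  rw [h3, map_smul, map_add, h1]
  simp

/-- Converse of the previous argument. Since `𝒢` has degree 2, the spray vector is itself
horizontal, so `DL(S) = 0`, and this can be differentiated vertically. -/
theorem isEulerLagrange_of_horizontal (hΩ : IsOpen Ω) (hL : ContDiffOn ℝ ∞ L Ω)
    (h𝒢 : ContDiffOn ℝ ∞ 𝒢 Ω)
    (hEuler : ∀ p ∈ Ω, fderiv ℝ 𝒢 p (0, p.2) = (2 : ℝ) • 𝒢 p)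
    (hH : ∀ p ∈ Ω, ∀ h, fderiv ℝ L p (h, -fderiv ℝ 𝒢 p (0, h)) = 0) {p : E × E} (hp : p ∈ Ω) :
    IsEulerLagrange 𝒢 L p := by
  intro h
  have hLp := hL.contDiffAt (hΩ.mem_nhds hp)
  have h1 := fderiv_fderiv_add_eq hLp
    (hasFDerivAt_sprayVector (h𝒢.contDiffAt (hΩ.mem_nhds hp))) (hasFDerivAt_const (0 : ℝ) p)
    (Filter.eventually_of_mem (hΩ.mem_nhds hp)
      fun q hq => by
        have := hH q hq q.2
        rwa [hEuler q hq, ← neg_smul] at this) (0, h)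
  rw [fderiv_fderiv_comm hLp] at h1
  have h2 : ((ContinuousLinearMap.snd ℝ E E).prod (-(2 : ℝ) • fderiv ℝ 𝒢 p)) (0, h) =
      (2 : ℝ) • (h, -fderiv ℝ 𝒢 p (0, h)) - (h, 0) := by
    refine Prod.ext ?_ ?_ <;> simp
    module
  rw [h2, map_sub, map_smul, hH p hp h] at h1
  simp at h1
  linarith

/-- The spray `S` and the horizontal field of `h` both annihilate `L`, hence so does their bracket.
Concretely, the first identity is differentiated along `(h, 0)` and the second along `S`. The second
derivatives of `L` cancel through the Euler-Lagrange equation for `∂̇_h 𝒢`, leaving the vertical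
vector of curvature. -/
theorem fderiv_riemannVector_eq_zero (hΩ : IsOpen Ω) (hL : ContDiffOn ℝ ∞ L Ω)
    (h𝒢 : ContDiffOn ℝ ∞ 𝒢 Ω)
    (hEuler : ∀ p ∈ Ω, fderiv ℝ L p (0, p.2) = 2 * L p)
    (hEL : ∀ p ∈ Ω, IsEulerLagrange 𝒢 L p) {p : E × E} (hp : p ∈ Ω) (h : E) :
    fderiv ℝ L p (0, riemannVector 𝒢 p h) = 0 := by
  have hLp := hL.contDiffAt (hΩ.mem_nhds hp)
  have h𝒢p := h𝒢.contDiffAt (hΩ.mem_nhds hp)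
  have h1 := fderiv_fderiv_add_eq hLp (hasFDerivAt_sprayVector h𝒢p) (hasFDerivAt_const (0 : ℝ) p)
    (Filter.eventually_of_mem (hΩ.mem_nhds hp)
      fun q hq => fderiv_sprayVector_eq_zero hΩ hL hEuler hEL hq) (h, 0)
  have h2 := fderiv_fderiv_add_eq hLp (hasFDerivAt_horizontal h𝒢p h) (hasFDerivAt_const (0 : ℝ) p)
    (Filter.eventually_of_mem (hΩ.mem_nhds hp)
      fun q hq => fderiv_horizontal_eq_zero hΩ hL h𝒢 hEuler hEL hq h) (sprayVector 𝒢 p)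
  have h3 := hEL p hp (fderiv ℝ 𝒢 p (0, h))
  have h4 := fderiv_horizontal_eq_zero hΩ hL h𝒢 hEuler hEL hp (fderiv ℝ 𝒢 p (0, h))
  rw [fderiv_fderiv_comm hLp] at h1
  rw [prod_split] at h2 h4
  have e : ((0 : E), riemannVector 𝒢 p h) = -(0, -(2 : ℝ) • fderiv ℝ 𝒢 p (h, 0)) +
      (0, -fderiv ℝ (fderiv ℝ 𝒢) p (sprayVector 𝒢 p) (0, h)) +
      (0, -fderiv ℝ 𝒢 p (0, fderiv ℝ 𝒢 p (0, h))) := by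
    refine Prod.ext ?_ ?_ <;> simp [riemannVector]
    module
  have e2 : ((0 : E), -fderiv ℝ 𝒢 p (0, h)) = -(0, fderiv ℝ 𝒢 p (0, h)) := by simp
  rw [e2, map_neg] at h2
  rw [e, map_add, map_add, map_neg]
  change _ + fderiv ℝ L p (0, -(2 : ℝ) • fderiv ℝ 𝒢 p (h, 0)) = 0 at h1
  change _ + fderiv ℝ L p (0, -fderiv ℝ (fderiv ℝ 𝒢) p (sprayVector 𝒢 p) (0, h)) = 0 at h2
  linarith

/-- The curvature of the connection is one third of the vertical antisymmetrisation of the Riemann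
curvature, so it vanishes along with it. -/
theorem connection_curvature_comm (hΩ : IsOpen Ω) (h𝒢 : ContDiffOn ℝ ∞ 𝒢 Ω)
    (hR : ∀ p ∈ Ω, ∀ h, riemannVector 𝒢 p h = 0) {p : E × E} (hp : p ∈ Ω) (a b : E) :
    fderiv ℝ (connection 𝒢) p (a, -connection 𝒢 p a) b =
      fderiv ℝ (connection 𝒢) p (b, -connection 𝒢 p b) a := by
  have h𝒢p := h𝒢.contDiffAt (hΩ.mem_nhds hp)
  have hd𝒢p := contDiffAt_fderiv h𝒢p
  have hconn : ∀ v c, fderiv ℝ (connection 𝒢) p v c = fderiv ℝ (fderiv ℝ 𝒢) p v (0, c) := by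
    intro v c
    have : HasFDerivAt (connection 𝒢) _ p :=
      (hasFDerivAt_fderiv hd𝒢p).clm_comp (hasFDerivAt_const (ContinuousLinearMap.inr ℝ E E) p)
    rw [this.fderiv]
    simp
  -- The vertical derivative along `j` of the identity `riemannVector 𝒢 q h = 0`.
  have key : ∀ j h : E, (2 : ℝ) • fderiv ℝ (fderiv ℝ 𝒢) p (0, j) (h, 0) -
      (fderiv ℝ (fderiv ℝ (fderiv ℝ 𝒢)) p (0, j) (sprayVector 𝒢 p) (0, h) +
        fderiv ℝ (fderiv ℝ 𝒢) p (j, -(2 : ℝ) • fderiv ℝ 𝒢 p (0, j)) (0, h)) -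
      (fderiv ℝ (fderiv ℝ 𝒢) p (0, j) (0, fderiv ℝ 𝒢 p (0, h)) +
        fderiv ℝ 𝒢 p (0, fderiv ℝ (fderiv ℝ 𝒢) p (0, j) (0, h))) = 0 := by
    intro j h
    have t1 := hasFDerivAt_fderiv_apply h𝒢p (hasFDerivAt_const (h, (0 : E)) p)
    have t2 := (hasFDerivAt_fderiv_apply hd𝒢p (hasFDerivAt_sprayVector h𝒢p)).clm_apply
      (hasFDerivAt_const ((0 : E), h) p)
    have t3 := hasFDerivAt_fderiv_apply h𝒢p
      (((hasFDerivAt_const (0 : E) p)).prodMk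
        (hasFDerivAt_fderiv_apply h𝒢p (hasFDerivAt_const ((0 : E), h) p)))
    have t4 := ((t1.const_smul (2 : ℝ)).sub t2).sub t3
    have t5 := t4.unique ((hasFDerivAt_const (0 : E) p).congr_of_eventuallyEq
      (Filter.eventually_of_mem (hΩ.mem_nhds hp) fun q hq => hR q hq h))
    have t6 := DFunLike.congr_fun t5 (0, j)
    refine Eq.trans ?_ t6
    simp
    abel
  have symm3 : ∀ u v w, fderiv ℝ (fderiv ℝ (fderiv ℝ 𝒢)) p u v w =
      fderiv ℝ (fderiv ℝ (fderiv ℝ 𝒢)) p u w v := by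
    intro u v w
    have s1 := hasFDerivAt_fderiv_apply hd𝒢p (hasFDerivAt_const v p)
    have s2 := hasFDerivAt_fderiv_apply hd𝒢p (hasFDerivAt_const w p)
    have s3 := s1.clm_apply (hasFDerivAt_const w p)
    have s4 := s2.clm_apply (hasFDerivAt_const v p)
    have s5 := s3.unique (s4.congr_of_eventuallyEq
      (Filter.eventually_of_mem (hΩ.mem_nhds hp) fun q hq =>
        fderiv_fderiv_comm (h𝒢.contDiffAt (hΩ.mem_nhds hq)) v w))
    have s6 := DFunLike.congr_fun s5 u
    simpa using s6
  -- The third-order term is symmetric in `a` and `b`, so it disappears from the antisymmetrisation.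
  have hthird : fderiv ℝ (fderiv ℝ (fderiv ℝ 𝒢)) p (0, a) (sprayVector 𝒢 p) (0, b) =
      fderiv ℝ (fderiv ℝ (fderiv ℝ 𝒢)) p (0, b) (sprayVector 𝒢 p) (0, a) := by
    rw [fderiv_fderiv_comm hd𝒢p, symm3, fderiv_fderiv_comm hd𝒢p]
  have k1 := key a b
  have k2 := key b a
  have c2 := fderiv_fderiv_comm h𝒢p
  have sp : ∀ (x y : E) w, fderiv ℝ (fderiv ℝ 𝒢) p (x, y) w =
      fderiv ℝ (fderiv ℝ 𝒢) p (x, 0) w + fderiv ℝ (fderiv ℝ 𝒢) p (0, y) w := by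
    intro x y w
    rw [← add_apply, ← map_add]
    simp
  have sm : ∀ (y : E) w, fderiv ℝ (fderiv ℝ 𝒢) p (0, -(2 : ℝ) • y) w =
      -(2 : ℝ) • fderiv ℝ (fderiv ℝ 𝒢) p (0, y) w := by
    intro y w
    rw [← smul_apply, ← map_smul]
    simp
  have sn : ∀ (y : E) w, fderiv ℝ (fderiv ℝ 𝒢) p (0, -y) w =
      -fderiv ℝ (fderiv ℝ 𝒢) p (0, y) w := by
    intro y w
    rw [← neg_apply, ← map_neg]
    simp
  rw [hconn, hconn, connection_apply, connection_apply, sp, sp b, sn, sn]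
  rw [sp a, sm, hthird, c2 (0, a) (b, 0), c2 (0, a) (0, fderiv ℝ 𝒢 p (0, b)),
    c2 (0, a) (0, b)] at k1
  rw [sp b, sm, c2 (0, b) (a, 0), c2 (0, b) (0, fderiv ℝ 𝒢 p (0, a))] at k2
  have k3 := k2.trans k1.symm
  rw [← sub_eq_zero] at k3 ⊢
  refine Eq.trans ?_ ((congrArg (fun z => (1 / 3 : ℝ) • z) k3).trans (smul_zero _))
  module

end Metrics

/-! ### Comparison with the coordinate expressions -/

section Coordinates

open Topology

variable {n : ℕ}

theorem sum_mul_apply_single {F : Type*} [AddCommMonoid F] [Module ℝ F]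
    (T : EuclideanSpace ℝ (Fin n) →ₗ[ℝ] F) (v : EuclideanSpace ℝ (Fin n)) :
    ∑ j, v j • T (EuclideanSpace.single j 1) = T v := by
  conv_rhs => rw [← (EuclideanSpace.basisFun (Fin n) ℝ).sum_repr v]
  simp [map_sum]

theorem sum_mul_dx (f : EuclideanSpace ℝ (Fin n) × EuclideanSpace ℝ (Fin n) → ℝ)
    (p : EuclideanSpace ℝ (Fin n) × EuclideanSpace ℝ (Fin n)) (v : EuclideanSpace ℝ (Fin n)) :
    ∑ j, v j * dx j f p = fderiv ℝ f p (v, 0) :=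
  sum_mul_apply_single ((fderiv ℝ f p).toLinearMap ∘ₗ LinearMap.inl ℝ _ _) v

theorem sum_mul_dy (f : EuclideanSpace ℝ (Fin n) × EuclideanSpace ℝ (Fin n) → ℝ)
    (p : EuclideanSpace ℝ (Fin n) × EuclideanSpace ℝ (Fin n)) (v : EuclideanSpace ℝ (Fin n)) :
    ∑ j, v j * dy j f p = fderiv ℝ f p (0, v) :=
  sum_mul_apply_single ((fderiv ℝ f p).toLinearMap ∘ₗ LinearMap.inr ℝ _ _) v

variable {𝒢 : EuclideanSpace ℝ (Fin n) × EuclideanSpace ℝ (Fin n) → EuclideanSpace ℝ (Fin n)}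
  {L : EuclideanSpace ℝ (Fin n) × EuclideanSpace ℝ (Fin n) → ℝ}
  {p : EuclideanSpace ℝ (Fin n) × EuclideanSpace ℝ (Fin n)}

theorem contDiffAt_component (h𝒢 : ContDiffAt ℝ ∞ 𝒢 p) (i : Fin n) :
    ContDiffAt ℝ ∞ (fun q => 𝒢 q i) p :=
  (EuclideanSpace.proj (𝕜 := ℝ) i).contDiff.contDiffAt.comp p h𝒢

theorem fderiv_component (h𝒢 : DifferentiableAt ℝ 𝒢 p) (i : Fin n)
    (v : EuclideanSpace ℝ (Fin n) × EuclideanSpace ℝ (Fin n)) :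
    fderiv ℝ (fun q => 𝒢 q i) p v = fderiv ℝ 𝒢 p v i := by
  have : HasFDerivAt (fun q => 𝒢 q i) ((EuclideanSpace.proj (𝕜 := ℝ) i).comp (fderiv ℝ 𝒢 p)) p :=
    (EuclideanSpace.proj (𝕜 := ℝ) i).hasFDerivAt.comp p h𝒢.hasFDerivAt
  rw [this.fderiv]
  rfl

theorem fderiv_fderiv_component (h𝒢 : ContDiffAt ℝ ∞ 𝒢 p) (i : Fin n)
    (v w : EuclideanSpace ℝ (Fin n) × EuclideanSpace ℝ (Fin n)) :
    fderiv ℝ (fderiv ℝ (fun q => 𝒢 q i)) p v w = fderiv ℝ (fderiv ℝ 𝒢) p v w i := by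
  rw [← fderiv_fderiv_apply_const (contDiffAt_component h𝒢 i),
    ← fderiv_fderiv_apply_const h𝒢]
  have hd : DifferentiableAt ℝ (fun q => fderiv ℝ 𝒢 q w) p :=
    (hasFDerivAt_fderiv_apply h𝒢 (hasFDerivAt_const w p)).differentiableAt
  rw [← fderiv_component hd]
  have hev : ∀ᶠ q in 𝓝 p, DifferentiableAt ℝ 𝒢 q := by
    have h1 : ContDiffAt ℝ 1 𝒢 p := h𝒢.of_le (by simp)
    filter_upwards [h1.eventually (by simp)] with q hq using hq.differentiableAt (by simp)
  have : (fun q => fderiv ℝ (fun q => 𝒢 q i) q w) =ᶠ[𝓝 p] fun q => fderiv ℝ 𝒢 q w i := by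
    filter_upwards [hev] with q hq using fderiv_component hq i w
  rw [this.fderiv_eq]

/-- The sums against `yʲ` and `-2 Gʲ` together form one derivative along the spray vector. -/
theorem riemannCurvature_eq (h𝒢 : ContDiffAt ℝ ∞ 𝒢 p) (i k : Fin n) :
    riemannCurvature (fun i q => 𝒢 q i) i k p =
      riemannVector 𝒢 p (EuclideanSpace.single k 1) i := by
  have hd : DifferentiableAt ℝ 𝒢 p := h𝒢.differentiableAt (by simp)
  have hc := contDiffAt_component h𝒢 i
  have e1 : dx k (fun q => 𝒢 q i) p = fderiv ℝ 𝒢 p (EuclideanSpace.single k 1, 0) i :=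
    fderiv_component hd i _
  have e2 : fderiv ℝ (dy k fun q => 𝒢 q i) p (p.2, 0) =
      fderiv ℝ (fderiv ℝ 𝒢) p (p.2, 0) (0, EuclideanSpace.single k 1) i :=
    (fderiv_fderiv_apply_const hc _ _).trans (fderiv_fderiv_component h𝒢 i _ _)
  have e3 : fderiv ℝ (dy k fun q => 𝒢 q i) p (0, 𝒢 p) =
      fderiv ℝ (fderiv ℝ 𝒢) p (0, 𝒢 p) (0, EuclideanSpace.single k 1) i :=
    (fderiv_fderiv_apply_const hc _ _).trans (fderiv_fderiv_component h𝒢 i _ _)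
  have e4 : ∑ j, dy j (fun q => 𝒢 q i) p * dy k (fun q => 𝒢 q j) p =
      fderiv ℝ 𝒢 p (0, fderiv ℝ 𝒢 p (0, EuclideanSpace.single k 1)) i := by
    rw [← fderiv_component hd, ← sum_mul_dy]
    refine Finset.sum_congr rfl fun j _ => ?_
    rw [mul_comm]
    exact congrArg (· * _) (fderiv_component hd j _)
  have e5 : sprayVector 𝒢 p = (p.2, 0) + (-2 : ℝ) • ((0, 𝒢 p) :
      EuclideanSpace ℝ (Fin n) × EuclideanSpace ℝ (Fin n)) := by
    simp [sprayVector]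
  unfold riemannCurvature riemannVector
  rw [e1, sum_mul_dx, sum_mul_dy, e2, e3, e4, e5]
  simp only [map_add, map_smul, add_apply, smul_apply, PiLp.sub_apply, PiLp.smul_apply,
    PiLp.add_apply, smul_eq_mul]
  ring

/-- The quadratic form `∂̇∂̇L` is nondegenerate. -/
def IsNondegenerateAt {E : Type*} [NormedAddCommGroup E] [NormedSpace ℝ E] (L : E × E → ℝ)
    (p : E × E) : Prop :=
  ∀ k : E, (∀ h : E, fderiv ℝ (fderiv ℝ L) p (0, k) (0, h) = 0) → k = 0

theorem fundamentalTensor_apply (hL : ContDiffAt ℝ ∞ L p) (i j : Fin n) :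
    fundamentalTensor L p i j = (1 / 2 : ℝ) * fderiv ℝ (fderiv ℝ L) p
      (0, EuclideanSpace.single j 1) (0, EuclideanSpace.single i 1) :=
  congrArg (_ * ·) (fderiv_fderiv_apply_const hL _ _)

theorem fundamentalTensor_mulVec (hL : ContDiffAt ℝ ∞ L p) (k : EuclideanSpace ℝ (Fin n))
    (i : Fin n) :
    (fundamentalTensor L p).mulVec k i = (1 / 2 : ℝ) * fderiv ℝ (fderiv ℝ L) p
      (0, k) (0, EuclideanSpace.single i 1) := by
  have := sum_mul_apply_single (((fderiv ℝ (fderiv ℝ L) p).flip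
    (0, EuclideanSpace.single i 1)).toLinearMap ∘ₗ LinearMap.inr ℝ _ _) k
  change _ = fderiv ℝ (fderiv ℝ L) p (0, k) (0, EuclideanSpace.single i 1) at this
  rw [← this, Finset.mul_sum]
  change ∑ j, fundamentalTensor L p i j * k j = _
  refine Finset.sum_congr rfl fun j _ => ?_
  rw [fundamentalTensor_apply hL]
  simp
  ring

theorem eq_zero_of_apply_single {F : Type*} [AddCommMonoid F] [Module ℝ F]
    (T : EuclideanSpace ℝ (Fin n) →ₗ[ℝ] F) (h : ∀ i, T (EuclideanSpace.single i 1) = 0)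
    (v : EuclideanSpace ℝ (Fin n)) : T v = 0 := by
  rw [← sum_mul_apply_single T]
  simp [h]

theorem det_fundamentalTensor_ne_zero_iff (hL : ContDiffAt ℝ ∞ L p) :
    (fundamentalTensor L p).det ≠ 0 ↔ IsNondegenerateAt L p := by
  rw [← not_iff_not, not_not, ← Matrix.exists_mulVec_eq_zero_iff]
  have key : ∀ k : EuclideanSpace ℝ (Fin n), (fundamentalTensor L p).mulVec k = 0 ↔
      ∀ h, fderiv ℝ (fderiv ℝ L) p (0, k) (0, h) = 0 := by
    intro k
    constructor
    · intro hk
      refine eq_zero_of_apply_single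
        ((fderiv ℝ (fderiv ℝ L) p (0, k)).toLinearMap ∘ₗ LinearMap.inr ℝ _ _) fun i => ?_
      have := congrFun hk i
      rw [fundamentalTensor_mulVec hL] at this
      simpa using this
    · intro hk
      funext i
      rw [fundamentalTensor_mulVec hL, hk]
      simp
  unfold IsNondegenerateAt
  push Not
  constructor
  · rintro ⟨v, hv, h⟩
    refine ⟨WithLp.toLp 2 v, (key (WithLp.toLp 2 v)).1 h, fun h0 => hv ?_⟩
    simpa using h0
  · rintro ⟨k, hk, h0⟩
    refine ⟨k, fun h => h0 ?_, (key k).2 hk⟩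
    ext i
    exact congrFun h i

/-- Tested on basis vectors, the Euler-Lagrange equations form the linear system `g 𝒢 = b / 4`. The
factor comes from the `-2` in the spray vector and the `1/2` in the fundamental tensor. -/
theorem isEulerLagrange_iff (hL : ContDiffAt ℝ ∞ L p) (hdet : (fundamentalTensor L p).det ≠ 0) :
    IsEulerLagrange 𝒢 L p ↔ ∀ i, 𝒢 p i = inducedCoeff L i p := by
  set b : Fin n → ℝ := fun l => (∑ k, dy l (dx k L) p * p.2 k) - dx l L p with hb
  have hbl : ∀ l, b l = fderiv ℝ (fderiv ℝ L) p (p.2, 0) (0, EuclideanSpace.single l 1) -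
      fderiv ℝ L p (EuclideanSpace.single l 1, 0) := by
    intro l
    have := sum_mul_apply_single (((fderiv ℝ (fderiv ℝ L) p).flip
      (0, EuclideanSpace.single l 1)).toLinearMap ∘ₗ LinearMap.inl ℝ _ _) p.2
    change _ = fderiv ℝ (fderiv ℝ L) p (p.2, 0) (0, EuclideanSpace.single l 1) at this
    rw [← this]
    refine congrArg (· - _) (Finset.sum_congr rfl fun k _ => ?_)
    rw [mul_comm]
    refine congrArg (_ * ·) ?_
    exact (fderiv_fderiv_apply_const hL _ _).trans (fderiv_fderiv_comm hL _ _)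
  have hunit : IsUnit (fundamentalTensor L p).det := isUnit_iff_ne_zero.2 hdet
  have h1 : (∀ i, 𝒢 p i = inducedCoeff L i p) ↔
      (fundamentalTensor L p).mulVec (𝒢 p) = (1 / 4 : ℝ) • b := by
    have h2 : (∀ i, 𝒢 p i = inducedCoeff L i p) ↔
        (𝒢 p : Fin n → ℝ) = (fundamentalTensor L p)⁻¹.mulVec ((1 / 4 : ℝ) • b) := by
      rw [Matrix.mulVec_smul]
      exact funext_iff.symm
    rw [h2]
    constructor
    · intro h
      rw [h, Matrix.mulVec_mulVec, Matrix.mul_nonsing_inv _ hunit, Matrix.one_mulVec]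
    · intro h
      rw [← h, Matrix.mulVec_mulVec, Matrix.nonsing_inv_mul _ hunit, Matrix.one_mulVec]
  have e5 : sprayVector 𝒢 p = (p.2, 0) + (-2 : ℝ) • ((0, 𝒢 p) :
      EuclideanSpace ℝ (Fin n) × EuclideanSpace ℝ (Fin n)) := by
    simp [sprayVector]
  have h3 : IsEulerLagrange 𝒢 L p ↔ ∀ l, fderiv ℝ (fderiv ℝ L) p (sprayVector 𝒢 p)
      (0, EuclideanSpace.single l 1) = fderiv ℝ L p (EuclideanSpace.single l 1, 0) := by
    refine ⟨fun h l => h _, fun h v => ?_⟩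
    rw [← sub_eq_zero]
    refine eq_zero_of_apply_single
      ((fderiv ℝ (fderiv ℝ L) p (sprayVector 𝒢 p)).toLinearMap ∘ₗ LinearMap.inr ℝ _ _ -
        (fderiv ℝ L p).toLinearMap ∘ₗ LinearMap.inl ℝ _ _) (fun l => ?_) v
    exact sub_eq_zero.2 (h l)
  rw [h1, h3, funext_iff]
  refine forall_congr' fun l => ?_
  rw [fundamentalTensor_mulVec hL, Pi.smul_apply, hbl, e5]
  simp only [map_add, map_smul, add_apply, smul_apply, smul_eq_mul]
  constructor <;> intro h <;> linarith

end Coordinates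

/-! ### Homogeneity -/

section Homogeneity

open Topology

variable {E F : Type*} [NormedAddCommGroup E] [NormedSpace ℝ E]
  [NormedAddCommGroup F] [NormedSpace ℝ F] {f : E × E → F} {Ω : Set (E × E)}

/-- The fibrewise homothety `(x, y) ↦ (x, c y)`. -/
def fibreScale (E : Type*) [NormedAddCommGroup E] [NormedSpace ℝ E] (c : ℝ) :
    E × E →L[ℝ] E × E :=
  (ContinuousLinearMap.fst ℝ E E).prod (c • ContinuousLinearMap.snd ℝ E E)

@[simp]
theorem fibreScale_apply (c : ℝ) (p : E × E) : fibreScale E c p = (p.1, c • p.2) := rfl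

theorem fderiv_radial_of_homogeneous (hΩ : IsOpen Ω) (hf : DifferentiableOn ℝ f Ω)
    (hhom : ∀ p ∈ Ω, ∀ c : ℝ, 0 < c → f (p.1, c • p.2) = c ^ 2 • f p) {p : E × E} (hp : p ∈ Ω) :
    fderiv ℝ f p (0, p.2) = (2 : ℝ) • f p := by
  have h1 : HasDerivAt (fun c : ℝ => (p.1, c • p.2)) ((0, p.2) : E × E) 1 :=
    (hasDerivAt_const 1 p.1).prodMk (by simpa using (hasDerivAt_id (1 : ℝ)).smul_const p.2)
  have hd : HasFDerivAt f (fderiv ℝ f p) (p.1, (1 : ℝ) • p.2) := by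
    simpa using ((hf p hp).differentiableAt (hΩ.mem_nhds hp)).hasFDerivAt
  have h2 := hd.comp_hasDerivAt (1 : ℝ) h1
  have h3 : HasDerivAt (fun c : ℝ => c ^ 2 • f p) ((2 : ℝ) • f p) 1 := by
    simpa using (hasDerivAt_pow 2 (1 : ℝ)).smul_const (f p)
  refine h2.unique (h3.congr_of_eventuallyEq ?_)
  filter_upwards [Ioi_mem_nhds (zero_lt_one' ℝ)] with c hc using hhom p hp c hc

theorem fderiv_fibreScale (hΩ : IsOpen Ω) (hf : DifferentiableOn ℝ f Ω)
    (hcone : ∀ p ∈ Ω, ∀ c : ℝ, 0 < c → (p.1, c • p.2) ∈ Ω)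
    (hhom : ∀ p ∈ Ω, ∀ c : ℝ, 0 < c → f (p.1, c • p.2) = c ^ 2 • f p) {p : E × E} (hp : p ∈ Ω)
    {c : ℝ} (hc : 0 < c) (v : E × E) :
    fderiv ℝ f (p.1, c • p.2) (fibreScale E c v) = c ^ 2 • fderiv ℝ f p v := by
  have hp' := hcone p hp c hc
  have h1 : HasFDerivAt (fun q => f (fibreScale E c q)) _ p :=
    ((hf _ hp').differentiableAt (hΩ.mem_nhds hp')).hasFDerivAt.comp p (fibreScale E c).hasFDerivAt
  have h2 := ((hf p hp).differentiableAt (hΩ.mem_nhds hp)).hasFDerivAt.const_smul (c ^ 2)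
  have h3 := h1.unique (h2.congr_of_eventuallyEq
    (Filter.eventually_of_mem (hΩ.mem_nhds hp) fun q hq => hhom q hq c hc))
  exact DFunLike.congr_fun h3 v

theorem fderiv_fderiv_fibreScale (hΩ : IsOpen Ω) (hf : ContDiffOn ℝ ∞ f Ω)
    (hcone : ∀ p ∈ Ω, ∀ c : ℝ, 0 < c → (p.1, c • p.2) ∈ Ω)
    (hhom : ∀ p ∈ Ω, ∀ c : ℝ, 0 < c → f (p.1, c • p.2) = c ^ 2 • f p) {p : E × E} (hp : p ∈ Ω)
    {c : ℝ} (hc : 0 < c) (v w : E × E) :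
    fderiv ℝ (fderiv ℝ f) (p.1, c • p.2) (fibreScale E c v) (fibreScale E c w) =
      c ^ 2 • fderiv ℝ (fderiv ℝ f) p v w := by
  have hp' := hcone p hp c hc
  have h1 := (hasFDerivAt_fderiv_apply (hf.contDiffAt (hΩ.mem_nhds hp'))
    (hasFDerivAt_const (fibreScale E c w) _)).comp p (fibreScale E c).hasFDerivAt
  have h2 := (hasFDerivAt_fderiv_apply (hf.contDiffAt (hΩ.mem_nhds hp))
    (hasFDerivAt_const w p)).const_smul (c ^ 2)
  have h3 := h1.unique (h2.congr_of_eventuallyEq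
    (Filter.eventually_of_mem (hΩ.mem_nhds hp) fun q hq =>
      fderiv_fibreScale hΩ (hf.differentiableOn (by simp)) hcone hhom hq hc w))
  simpa using DFunLike.congr_fun h3 v

end Homogeneity

/-! ### Local metrizability of flat sprays -/

section LocalMetric

open Topology Metric Set

variable {n : ℕ}
  {𝒢 : EuclideanSpace ℝ (Fin n) × EuclideanSpace ℝ (Fin n) → EuclideanSpace ℝ (Fin n)}
  {Ω : Set (EuclideanSpace ℝ (Fin n) × EuclideanSpace ℝ (Fin n))}

theorem contDiffAt_connection {E : Type*} [NormedAddCommGroup E] [NormedSpace ℝ E]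
    {𝒢 : E × E → E} {p : E × E} (h𝒢 : ContDiffAt ℝ ∞ 𝒢 p) : ContDiffAt ℝ ∞ (connection 𝒢) p :=
  (contDiffAt_fderiv h𝒢).clm_comp contDiffAt_const

theorem connection_fibreScale {E : Type*} [NormedAddCommGroup E] [NormedSpace ℝ E]
    {𝒢 : E × E → E} {Ω : Set (E × E)} (hΩ : IsOpen Ω) (h𝒢 : ContDiffOn ℝ ∞ 𝒢 Ω)
    (hcone : ∀ p ∈ Ω, ∀ c : ℝ, 0 < c → (p.1, c • p.2) ∈ Ω)
    (hhom : ∀ p ∈ Ω, ∀ c : ℝ, 0 < c → 𝒢 (p.1, c • p.2) = c ^ 2 • 𝒢 p) {p : E × E} (hp : p ∈ Ω)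
    {c : ℝ} (hc : 0 < c) : connection 𝒢 (p.1, c • p.2) = c • connection 𝒢 p := by
  ext h
  have h1 := fderiv_fibreScale hΩ (h𝒢.differentiableOn (by simp)) hcone hhom hp hc (0, h)
  have h2 : fibreScale E c (0, h) = c • ((0, h) : E × E) := by simp
  rw [h2, map_smul, pow_two, mul_smul] at h1
  exact smul_right_injective E hc.ne' h1

/-- Near `(x₀, y₀)`, a spray with vanishing curvature has a smooth map `Y` to the fibre over `x₀`
which is invariant under parallel transport and locally homogeneous. -/
theorem exists_parallel_of_flat (hΩ : IsOpen Ω) (h𝒢 : ContDiffOn ℝ ∞ 𝒢 Ω)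
    (hcone : ∀ p ∈ Ω, ∀ c : ℝ, 0 < c → (p.1, c • p.2) ∈ Ω)
    (hhom : ∀ p ∈ Ω, ∀ c : ℝ, 0 < c → 𝒢 (p.1, c • p.2) = c ^ 2 • 𝒢 p)
    (hR : ∀ p ∈ Ω, ∀ h, riemannVector 𝒢 p h = 0)
    {x₀ y₀ : EuclideanSpace ℝ (Fin n)} (h₀ : (x₀, y₀) ∈ Ω) :
    ∃ (Y : EuclideanSpace ℝ (Fin n) × EuclideanSpace ℝ (Fin n) → EuclideanSpace ℝ (Fin n))
      (W : Set (EuclideanSpace ℝ (Fin n) × EuclideanSpace ℝ (Fin n))), IsOpen W ∧ (x₀, y₀) ∈ W ∧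
      ContDiffOn ℝ ∞ Y W ∧ (∀ y, (x₀, y) ∈ W → Y (x₀, y) = y) ∧
      (∀ p ∈ W, ∀ h, fderiv ℝ Y p (h, -connection 𝒢 p h) = 0) ∧
      ∀ᶠ q : ℝ × (EuclideanSpace ℝ (Fin n) × EuclideanSpace ℝ (Fin n)) in 𝓝 (1, (x₀, y₀)),
        Y (q.2.1, q.1 • q.2.2) = q.1 • Y q.2 := by
  obtain ⟨r, hr, hrΩ⟩ := Metric.nhds_basis_closedBall.mem_iff.1 (hΩ.mem_nhds h₀)
  -- Transport was set up for a connection smooth on the whole space, so the connection is cut off.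
  -- It is unchanged on the ball of radius `r / 2`, and flatness and homogeneity are used only
  -- there.
  let f : ContDiffBump (x₀, y₀) := ⟨r / 2, r, by positivity, by linarith⟩
  let N : EuclideanSpace ℝ (Fin n) × EuclideanSpace ℝ (Fin n) →
    EuclideanSpace ℝ (Fin n) →L[ℝ] EuclideanSpace ℝ (Fin n) := fun p => f p • connection 𝒢 p
  have hN : ContDiff ℝ ∞ N := by
    refine contDiff_iff_contDiffAt.2 fun p => ?_
    by_cases hp : p ∈ closedBall (x₀, y₀) r
    · exact f.contDiff.contDiffAt.smul
        (contDiffAt_connection (h𝒢.contDiffAt (hΩ.mem_nhds (hrΩ hp))))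
    · have : N =ᶠ[𝓝 p] fun _ => 0 := by
        filter_upwards [isClosed_closedBall.isOpen_compl.mem_nhds hp] with q hq
        have : f q = 0 := f.zero_of_le_dist (le_of_lt (by simpa using hq))
        simp [N, this]
      exact contDiffAt_const.congr_of_eventuallyEq this
  have hNeq : ∀ p ∈ ball (x₀, y₀) (r / 2), N p = connection 𝒢 p := fun p hp => by
    have : f p = 1 := f.one_of_mem_closedBall (ball_subset_closedBall hp)
    simp [N, this]
  have hball : ball (x₀, y₀) (r / 2) ⊆ Ω :=
    (ball_subset_closedBall.trans (closedBall_subset_closedBall (by linarith))).trans hrΩ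
  have hNd : ∀ p ∈ ball (x₀, y₀) (r / 2), fderiv ℝ N p = fderiv ℝ (connection 𝒢) p :=
    fun p hp => Filter.EventuallyEq.fderiv_eq
      (Filter.eventually_of_mem (isOpen_ball.mem_nhds hp) hNeq)
  obtain ⟨Y, W, hW, hW₀, hY, hY₀, hH, hs⟩ := exists_horizontally_constant hN (x₀ := x₀) (y₀ := y₀)
    isOpen_ball (mem_ball_self (by positivity : 0 < r / 2))
    (fun p hp a b => by
      rw [hNd p hp, hNeq p hp]
      exact connection_curvature_comm hΩ h𝒢 hR (hball hp) a b)
    (fun p hp c hc hp' => by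
      rw [hNeq p hp, hNeq _ hp']
      exact connection_fibreScale hΩ h𝒢 hcone hhom (hball hp) hc)
  refine ⟨Y, W ∩ ball (x₀, y₀) (r / 2), hW.inter isOpen_ball,
    ⟨hW₀, mem_ball_self (by positivity)⟩, hY.mono inter_subset_left, fun y hy => hY₀ y hy.1,
    fun p hp h => ?_, hs⟩
  rw [← hNeq p hp.2]
  exact hH p hp.1 h

theorem fderiv_fderiv_normSq {E : Type*} [NormedAddCommGroup E] [InnerProductSpace ℝ E]
    (p v w : E) : fderiv ℝ (fderiv ℝ fun y : E => ‖y‖ ^ 2) p v w = 2 * inner ℝ v w := by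
  have h1 : fderiv ℝ (fun y : E => ‖y‖ ^ 2) = fun y => (2 : ℝ) • innerSL ℝ y := by
    funext y
    rw [fderiv_norm_sq_apply]
    ext; simp [two_mul]
  have h2 : HasFDerivAt (fun y : E => (2 : ℝ) • innerSL ℝ y) ((2 : ℝ) • innerSL ℝ) p :=
    (innerSL ℝ : E →L[ℝ] E →L[ℝ] ℝ).hasFDerivAt.const_smul (2 : ℝ)
  rw [h1, h2.fderiv]
  simp
  rfl

/-- The vertical Hessian sees only the restriction of `L` to the fibre, where it is twice the inner
product; a vector in its kernel is tested against itself. -/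
theorem isNondegenerateAt_of_eq_normSq {E : Type*} [NormedAddCommGroup E] [InnerProductSpace ℝ E]
    {L : E × E → ℝ} {x₀ y₀ : E} (hL : ContDiffAt ℝ ∞ L (x₀, y₀))
    (h : ∀ᶠ y in 𝓝 y₀, L (x₀, y) = ‖y‖ ^ 2) : IsNondegenerateAt L (x₀, y₀) := by
  have hι : ∀ y : E, HasFDerivAt (fun y : E => (x₀, y)) (ContinuousLinearMap.inr ℝ E E) y :=
    fun y => (hasFDerivAt_const x₀ y).prodMk (hasFDerivAt_id y)
  have hev : ∀ᶠ y in 𝓝 y₀, DifferentiableAt ℝ L (x₀, y) := by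
    have h1 : ContDiffAt ℝ 1 L (x₀, y₀) := hL.of_le (by simp)
    have h2 := (hι y₀).continuousAt.eventually (h1.eventually (by simp))
    filter_upwards [h2] with y hy using hy.differentiableAt (by simp)
  intro k hk
  have e1 : (fun y => fderiv ℝ L (x₀, y) (0, k)) =ᶠ[𝓝 y₀]
      fun y => fderiv ℝ (fun y : E => ‖y‖ ^ 2) y k := by
    filter_upwards [hev, h.eventually_nhds] with y hy hy'
    have := (hy.hasFDerivAt.comp y (hι y)).congr_of_eventuallyEq
      (f₁ := fun y : E => ‖y‖ ^ 2) (by filter_upwards [hy'] with z hz using hz.symm)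
    rw [this.fderiv]
    rfl
  have hsq : ContDiffAt ℝ ∞ (fun y : E => ‖y‖ ^ 2) y₀ := (contDiff_norm_sq ℝ).contDiffAt
  have h1 := (hasFDerivAt_fderiv_apply hL (hasFDerivAt_const ((0 : E), k) _)).comp y₀ (hι y₀)
  have h2 := hasFDerivAt_fderiv_apply hsq (hasFDerivAt_const k y₀)
  have h3 := DFunLike.congr_fun (h1.unique (h2.congr_of_eventuallyEq e1)) k
  have h4 : fderiv ℝ (fderiv ℝ L) (x₀, y₀) (0, k) (0, k) = 2 * inner ℝ k k := by
    rw [← fderiv_fderiv_normSq y₀]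
    simpa using h3
  rw [hk] at h4
  exact inner_self_eq_zero (𝕜 := ℝ).1 (by linarith)

theorem eventually_isNondegenerateAt
    {L : EuclideanSpace ℝ (Fin n) × EuclideanSpace ℝ (Fin n) → ℝ}
    {p : EuclideanSpace ℝ (Fin n) × EuclideanSpace ℝ (Fin n)} (hΩ : IsOpen Ω)
    (hL : ContDiffOn ℝ ∞ L Ω) (hp : p ∈ Ω) (h : IsNondegenerateAt L p) :
    ∀ᶠ q in 𝓝 p, IsNondegenerateAt L q := by
  have hLp := hL.contDiffAt (hΩ.mem_nhds hp)
  have hc : ContinuousAt (fundamentalTensor L) p := by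
    refine continuousAt_pi.2 fun i => continuousAt_pi.2 fun j => ?_
    have : ContinuousAt (fun q => (1 / 2 : ℝ) * fderiv ℝ (fderiv ℝ L) q
        (0, EuclideanSpace.single j 1) (0, EuclideanSpace.single i 1)) p :=
      continuousAt_const.mul ((((contDiffAt_fderiv (contDiffAt_fderiv hLp)).continuousAt).clm_apply
        continuousAt_const).clm_apply continuousAt_const)
    refine this.congr ?_
    filter_upwards [hΩ.mem_nhds hp] with q hq
    exact (fundamentalTensor_apply (hL.contDiffAt (hΩ.mem_nhds hq)) i j).symm
  have hdet : ContinuousAt (fun q => (fundamentalTensor L q).det) p :=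
    (Continuous.matrix_det continuous_id).continuousAt.comp hc
  filter_upwards [hΩ.mem_nhds hp,
    hdet.eventually_ne ((det_fundamentalTensor_ne_zero_iff hLp).2 h)] with q hq hqdet
  exact (det_fundamentalTensor_ne_zero_iff (hL.contDiffAt (hΩ.mem_nhds hq))).1 hqdet

/-- A flat spray in a coordinate domain is induced by a metric on a cone around any direction. -/
theorem exists_local_metric (hΩ : IsOpen Ω) (h𝒢 : ContDiffOn ℝ ∞ 𝒢 Ω)
    (hcone : ∀ p ∈ Ω, ∀ c : ℝ, 0 < c → (p.1, c • p.2) ∈ Ω) (hne : ∀ p ∈ Ω, p.2 ≠ 0)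
    (hhom : ∀ p ∈ Ω, ∀ c : ℝ, 0 < c → 𝒢 (p.1, c • p.2) = c ^ 2 • 𝒢 p)
    (hR : ∀ p ∈ Ω, ∀ h, riemannVector 𝒢 p h = 0)
    {x₀ y₀ : EuclideanSpace ℝ (Fin n)} (h₀ : (x₀, y₀) ∈ Ω) :
    ∃ (U : Set (EuclideanSpace ℝ (Fin n)))
      (C : Set (EuclideanSpace ℝ (Fin n) × EuclideanSpace ℝ (Fin n)))
      (L : EuclideanSpace ℝ (Fin n) × EuclideanSpace ℝ (Fin n) → ℝ),
      IsOpen U ∧ x₀ ∈ U ∧ IsOpen C ∧ C ⊆ Ω ∧ Prod.fst '' C = U ∧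
      (∀ p ∈ C, ∀ c : ℝ, 0 < c → (p.1, c • p.2) ∈ C) ∧ ContDiffOn ℝ ∞ L C ∧
      (∀ p ∈ C, ∀ c : ℝ, 0 < c → L (p.1, c • p.2) = c ^ 2 * L p) ∧
      ∀ p ∈ C, L p ≠ 0 ∧ IsEulerLagrange 𝒢 L p ∧ IsNondegenerateAt L p := by
  wlog hy₀ : ‖y₀‖ = 1 generalizing y₀
  · have hpos : 0 < ‖y₀‖ := norm_pos_iff.2 (hne _ h₀)
    exact this (hcone _ h₀ ‖y₀‖⁻¹ (by positivity))
      (by rw [norm_smul, norm_inv, norm_norm, inv_mul_cancel₀ hpos.ne'])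
  obtain ⟨Y, W, hW, hW₀, hY, hY₀, hH, hs⟩ := exists_parallel_of_flat hΩ h𝒢 hcone hhom hR h₀
  -- Because `Y` is only locally homogeneous, `‖Y‖²` is evaluated at the unit direction and extended
  -- with degree 2. Near the unit vector `y₀` this agrees with `‖Y‖²`.
  let L : EuclideanSpace ℝ (Fin n) × EuclideanSpace ℝ (Fin n) → ℝ :=
    fun p => ‖p.2‖ ^ 2 * ‖Y (p.1, ‖p.2‖⁻¹ • p.2)‖ ^ 2
  have hLhom : ∀ p, ∀ c : ℝ, 0 < c → L (p.1, c • p.2) = c ^ 2 * L p := by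
    intro p c hc
    have : ‖c • p.2‖⁻¹ • c • p.2 = ‖p.2‖⁻¹ • p.2 := by
      rw [smul_smul, norm_smul, Real.norm_of_nonneg hc.le, mul_inv, mul_comm c⁻¹, mul_assoc,
        inv_mul_cancel₀ hc.ne', mul_one]
    simp only [L]
    rw [this, norm_smul, Real.norm_of_nonneg hc.le]
    ring
  have hLℓ : ∀ᶠ p in 𝓝 (x₀, y₀), L p = ‖Y p‖ ^ 2 := by
    have hc : ContinuousAt (fun p : EuclideanSpace ℝ (Fin n) × EuclideanSpace ℝ (Fin n) =>
        (‖p.2‖⁻¹, p)) (x₀, y₀) := by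
      refine ContinuousAt.prodMk (ContinuousAt.inv₀ (by fun_prop) ?_) continuousAt_id
      simp [hy₀]
    have h1 : Filter.Tendsto (fun p : EuclideanSpace ℝ (Fin n) × EuclideanSpace ℝ (Fin n) =>
        (‖p.2‖⁻¹, p)) (𝓝 (x₀, y₀)) (𝓝 (1, (x₀, y₀))) := by
      simpa [ContinuousAt, hy₀] using hc
    filter_upwards [h1.eventually hs, hΩ.mem_nhds h₀] with p hp hpΩ
    have hpos : 0 < ‖p.2‖ := norm_pos_iff.2 (hne _ hpΩ)
    simp only [L]
    rw [hp, norm_smul, norm_inv, norm_norm]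
    field_simp
  obtain ⟨V, hVsub, hV, hV₀⟩ := _root_.eventually_nhds_iff.1 (hLℓ.and
    ((hW.eventually_mem hW₀).and (hΩ.eventually_mem h₀)))
  have hLV : ContDiffOn ℝ ∞ L V :=
    ((hY.mono fun p hp => (hVsub p hp).2.1).norm_sq ℝ).congr fun p hp => (hVsub p hp).1
  have hHV : ∀ p ∈ V, ∀ h, fderiv ℝ L p (h, -connection 𝒢 p h) = 0 := by
    intro p hp h
    have hpW := (hVsub p hp).2.1
    have hd : HasFDerivAt Y (fderiv ℝ Y p) p :=
      hasFDerivAt_fderiv (hY.contDiffAt (hW.mem_nhds hpW))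
    have h1 := hd.norm_sq.congr_of_eventuallyEq
      (Filter.eventually_of_mem (hV.mem_nhds hp) fun q hq => (hVsub q hq).1)
    rw [h1.fderiv]
    simp [-connection_apply, hH p hpW h]
  have hnd₀ : IsNondegenerateAt L (x₀, y₀) := by
    refine isNondegenerateAt_of_eq_normSq (hLV.contDiffAt (hV.mem_nhds hV₀)) ?_
    have : ∀ᶠ y in 𝓝 y₀, (x₀, y) ∈ V :=
      (Continuous.prodMk_right x₀).continuousAt.preimage_mem_nhds (hV.mem_nhds hV₀)
    filter_upwards [this] with y hy
    rw [(hVsub _ hy).1, hY₀ y (hVsub _ hy).2.1]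
  have hL₀ : L (x₀, y₀) ≠ 0 := by
    rw [(hVsub _ hV₀).1, hY₀ y₀ hW₀, hy₀]
    norm_num
  obtain ⟨r, hr, hball⟩ := Metric.mem_nhds_iff.1 (Filter.inter_mem (hV.mem_nhds hV₀)
    ((eventually_isNondegenerateAt hV hLV hV₀ hnd₀).and
      ((hLV.contDiffAt (hV.mem_nhds hV₀)).continuousAt.eventually_ne hL₀)))
  rw [← ball_prod_same] at hball
  -- The cone over directions close to `y₀`. Normalising a point of `C` lands in `V`, where all
  -- required properties are known, and homogeneity transports them back.
  let C : Set (EuclideanSpace ℝ (Fin n) × EuclideanSpace ℝ (Fin n)) :=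
    {p | p.1 ∈ ball x₀ r ∧ p.2 ≠ 0 ∧ ‖p.2‖⁻¹ • p.2 ∈ ball y₀ r}
  have hC : IsOpen C := by
    have h1 : IsOpen {p : EuclideanSpace ℝ (Fin n) × EuclideanSpace ℝ (Fin n) | p.2 ≠ 0} :=
      isOpen_ne.preimage continuous_snd
    have h2 : ContinuousOn (fun p : EuclideanSpace ℝ (Fin n) × EuclideanSpace ℝ (Fin n) =>
        ‖p.2‖⁻¹ • p.2) {p | p.2 ≠ 0} :=
      (continuous_snd.norm.continuousOn.inv₀ fun p hp => norm_ne_zero_iff.2 hp).smul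
        continuous_snd.continuousOn
    exact (isOpen_ball.preimage continuous_fst).inter (h2.isOpen_inter_preimage h1 isOpen_ball)
  have hCcone : ∀ p ∈ C, ∀ c : ℝ, 0 < c → (p.1, c • p.2) ∈ C := by
    rintro p ⟨h1, h2, h3⟩ c hc
    refine ⟨h1, smul_ne_zero hc.ne' h2, ?_⟩
    have : ‖c • p.2‖⁻¹ • c • p.2 = ‖p.2‖⁻¹ • p.2 := by
      rw [smul_smul, norm_smul, Real.norm_of_nonneg hc.le, mul_inv, mul_comm c⁻¹, mul_assoc,
        inv_mul_cancel₀ hc.ne', mul_one]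
    simpa only [this] using h3
  have hunit : ∀ p ∈ C, ∃ c : ℝ, 0 < c ∧ ∃ q ∈ V, q ∈ C ∧ p = (q.1, c • q.2) ∧
      IsNondegenerateAt L q ∧ L q ≠ 0 := by
    intro p hp
    have hpos : 0 < ‖p.2‖ := norm_pos_iff.2 hp.2.1
    have hq := hball (⟨hp.1, hp.2.2⟩ : (p.1, ‖p.2‖⁻¹ • p.2) ∈ ball x₀ r ×ˢ ball y₀ r)
    refine ⟨‖p.2‖, hpos, _, hq.1, hCcone p hp _ (inv_pos.2 hpos), ?_, hq.2⟩
    simp [smul_smul, hpos.ne']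
  have hCΩ : C ⊆ Ω := by
    intro p hp
    obtain ⟨c, hc, q, hq, -, rfl, -⟩ := hunit p hp
    exact hcone q (hVsub q hq).2.2 c hc
  have hLC : ContDiffOn ℝ ∞ L C := by
    intro p hp
    obtain ⟨c, hc, q, hq, -, rfl, -⟩ := hunit p hp
    have h1 : L = fun z => c ^ 2 * L (fibreScale _ c⁻¹ z) := by
      funext z
      rw [fibreScale_apply, hLhom z c⁻¹ (inv_pos.2 hc)]
      field_simp
    have h2 : fibreScale (EuclideanSpace ℝ (Fin n)) c⁻¹ (q.1, c • q.2) = q := by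
      simp [smul_smul, hc.ne']
    have h3 : ContDiffAt ℝ ∞ L (fibreScale (EuclideanSpace ℝ (Fin n)) c⁻¹ (q.1, c • q.2)) := by
      rw [h2]
      exact hLV.contDiffAt (hV.mem_nhds hq)
    rw [h1]
    exact (contDiffAt_const.mul (h3.comp _
      (fibreScale (EuclideanSpace ℝ (Fin n)) c⁻¹).contDiff.contDiffAt)).contDiffWithinAt
  have hHC : ∀ p ∈ C, ∀ h, fderiv ℝ L p (h, -fderiv ℝ 𝒢 p (0, h)) = 0 := by
    intro p hp h
    obtain ⟨c, hc, q, hq, hqC, rfl, -⟩ := hunit p hp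
    have h1 := connection_fibreScale hΩ h𝒢 hcone hhom (hVsub q hq).2.2 hc
    have h2 := fderiv_fibreScale hC (hLC.differentiableOn (by simp)) hCcone
      (fun p _ c hc => hLhom p c hc) hqC hc (h, -connection 𝒢 q h)
    rw [hHV q hq h, smul_zero, fibreScale_apply] at h2
    rw [← connection_apply, h1, smul_apply, ← smul_neg]
    exact h2
  refine ⟨ball x₀ r, C, L, isOpen_ball, mem_ball_self hr, hC, hCΩ, ?_, hCcone, hLC,
    fun p _ c hc => hLhom p c hc, fun p hp => ⟨?_, ?_, ?_⟩⟩
  · ext x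
    constructor
    · rintro ⟨p, hp, rfl⟩
      exact hp.1
    · intro hx
      refine ⟨(x, y₀), ⟨hx, hne (x₀, y₀) h₀, ?_⟩, rfl⟩
      simpa [hy₀] using hr
  · obtain ⟨c, hc, q, -, -, rfl, -, hq⟩ := hunit p hp
    rw [hLhom q c hc]
    exact mul_ne_zero (by positivity) hq
  · refine isEulerLagrange_of_horizontal hC hLC (h𝒢.mono hCΩ) (fun q hq => ?_) hHC hp
    exact fderiv_radial_of_homogeneous hΩ (h𝒢.differentiableOn (by simp)) hhom (hCΩ hq)
  · obtain ⟨c, hc, q, -, hqC, rfl, hnd, -⟩ := hunit p hp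
    intro k hk
    -- Both vertical arguments scale by `c`, which cancels the factor `c ^ 2` and makes the vertical
    -- Hessian invariant along the ray.
    have := hnd (c⁻¹ • k) fun h => by
      have h1 := fderiv_fderiv_fibreScale hC hLC hCcone (fun p _ c hc => hLhom p c hc) hqC hc
        (0, c⁻¹ • k) (0, h)
      simp only [fibreScale_apply, smul_smul, mul_inv_cancel₀ hc.ne', one_smul] at h1
      rw [hk] at h1
      exact (smul_eq_zero.1 h1.symm).resolve_left (by positivity)
    exact (smul_eq_zero.1 this).resolve_left (inv_ne_zero hc.ne')

end LocalMetric

/-! ### Metrizable sprays of scalar curvature -/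

section ScalarCurvature

open Topology Metric Set

variable {n : ℕ}
  {𝒢 : EuclideanSpace ℝ (Fin n) × EuclideanSpace ℝ (Fin n) → EuclideanSpace ℝ (Fin n)}
  {L R : EuclideanSpace ℝ (Fin n) × EuclideanSpace ℝ (Fin n) → ℝ}
  {T : Fin n → EuclideanSpace ℝ (Fin n) × EuclideanSpace ℝ (Fin n) → ℝ}
  {Ω : Set (EuclideanSpace ℝ (Fin n) × EuclideanSpace ℝ (Fin n))}
  {p : EuclideanSpace ℝ (Fin n) × EuclideanSpace ℝ (Fin n)}

theorem contDiffOn_dx (hΩ : IsOpen Ω) (hL : ContDiffOn ℝ ∞ L Ω) (k : Fin n) :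
    ContDiffOn ℝ ∞ (dx k L) Ω := fun _ hp =>
  ((contDiffAt_fderiv (hL.contDiffAt (hΩ.mem_nhds hp))).clm_apply
    contDiffAt_const).contDiffWithinAt

theorem contDiffOn_dy (hΩ : IsOpen Ω) (hL : ContDiffOn ℝ ∞ L Ω) (k : Fin n) :
    ContDiffOn ℝ ∞ (dy k L) Ω := fun _ hp =>
  ((contDiffAt_fderiv (hL.contDiffAt (hΩ.mem_nhds hp))).clm_apply
    contDiffAt_const).contDiffWithinAt

theorem contDiffOn_horizontalDeriv (hΩ : IsOpen Ω)
    {G : Fin n → EuclideanSpace ℝ (Fin n) × EuclideanSpace ℝ (Fin n) → ℝ}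
    (hG : ∀ i, ContDiffOn ℝ ∞ (G i) Ω) (hT : ∀ i, ContDiffOn ℝ ∞ (T i) Ω) (i j : Fin n) :
    ContDiffOn ℝ ∞ (horizontalDeriv G T i j) Ω := by
  refine ((contDiffOn_dx hΩ (hT i) j).sub (ContDiffOn.sum fun r _ => ?_)).sub
    (ContDiffOn.sum fun r _ => ?_)
  · exact (contDiffOn_dy hΩ (hG r) j).mul (contDiffOn_dy hΩ (hT i) r)
  · exact (hT r).mul (contDiffOn_dy hΩ (contDiffOn_dy hΩ (hG r) i) j)

/-- Where the curvature is `R δ - τ ⊗ y`, a metric inducing the spray satisfies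
`R ∂̇ₖL = 2 τₖ L`. -/
theorem scalarCurvature_mul_dy (hΩ : IsOpen Ω) (hL : ContDiffOn ℝ ∞ L Ω) (h𝒢 : ContDiffOn ℝ ∞ 𝒢 Ω)
    (hEuler : ∀ p ∈ Ω, fderiv ℝ L p (0, p.2) = 2 * L p)
    (hEL : ∀ p ∈ Ω, IsEulerLagrange 𝒢 L p)
    (hR : ∀ p ∈ Ω, ∀ i k, riemannCurvature (fun i q => 𝒢 q i) i k p =
      R p * (if i = k then 1 else 0) - T k p * p.2 i) (hp : p ∈ Ω) (k : Fin n) :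
    R p * dy k L p = 2 * T k p * L p := by
  have h1 := fderiv_riemannVector_eq_zero hΩ hL h𝒢 hEuler hEL hp (EuclideanSpace.single k 1)
  have h2 : riemannVector 𝒢 p (EuclideanSpace.single k 1) =
      R p • EuclideanSpace.single k 1 - T k p • p.2 := by
    ext i
    rw [← riemannCurvature_eq (h𝒢.contDiffAt (hΩ.mem_nhds hp)), hR p hp]
    simp [eq_comm]
  have h3 : ((0 : EuclideanSpace ℝ (Fin n)), R p • EuclideanSpace.single k (1 : ℝ) - T k p • p.2) =
      R p • (0, EuclideanSpace.single k (1 : ℝ)) - T k p • (0, p.2) := by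
    simp
  rw [h2, h3, map_sub, map_smul, map_smul, hEuler p hp] at h1
  simp only [smul_eq_mul] at h1
  unfold dy
  linarith

/-- A function vanishing near `p` has zero Hessian there, so a basis vector would lie in its kernel.
The index `k` serves only to rule out dimension zero. -/
theorem not_eventually_eq_zero_of_isNondegenerateAt (hnd : IsNondegenerateAt L p) (k : Fin n) :
    ¬ ∀ᶠ q in 𝓝 p, L q = 0 := by
  intro h
  have h1 : fderiv ℝ L =ᶠ[𝓝 p] fun _ => 0 := by
    filter_upwards [h.eventually_nhds] with q hq
    have : L =ᶠ[𝓝 q] fun _ => 0 := hq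
    rw [this.fderiv_eq]
    simp
  have h2 : fderiv ℝ (fderiv ℝ L) p = 0 := by
    rw [h1.fderiv_eq]
    simp
  have := hnd (EuclideanSpace.single k 1) (fun h => by rw [h2]; rfl)
  simpa using congrArg (· k) this

/-- This replaces division by `L`, and works even where `L p = 0`: if `φ p ≠ 0`, then `φ` is nonzero
nearby and `L` would vanish on a neighbourhood. -/
theorem eq_zero_of_mul_eventually_eq_zero
    {φ : EuclideanSpace ℝ (Fin n) × EuclideanSpace ℝ (Fin n) → ℝ}
    (hnd : IsNondegenerateAt L p) (k : Fin n) (hφ : ContinuousAt φ p)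
    (h : ∀ᶠ q in 𝓝 p, 2 * L q * φ q = 0) : φ p = 0 := by
  by_contra hne
  refine not_eventually_eq_zero_of_isNondegenerateAt hnd k ?_
  filter_upwards [h, hφ.eventually_ne hne] with q hq hq'
  simpa [hq'] using hq

/-- The product rule for `2 L Tᵢ = ∂̇ᵢL`, which states that `T` is half the logarithmic derivative
without dividing by `L`. -/
theorem two_mul_fderiv_logDeriv
    (hΩ : IsOpen Ω) (hL : ContDiffOn ℝ ∞ L Ω) (hT : ∀ i, ContDiffOn ℝ ∞ (T i) Ω)
    (hTL : ∀ p ∈ Ω, ∀ i, 2 * L p * T i p = dy i L p)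
    (hp : p ∈ Ω) (i : Fin n)
    (v : EuclideanSpace ℝ (Fin n) × EuclideanSpace ℝ (Fin n)) :
    2 * fderiv ℝ L p v * T i p + 2 * L p * fderiv ℝ (T i) p v =
      fderiv ℝ (fderiv ℝ L) p v (0, EuclideanSpace.single i 1) := by
  have hLp := hL.contDiffAt (hΩ.mem_nhds hp)
  have h1 := ((hasFDerivAt_fderiv hLp).const_mul 2).mul
    (hasFDerivAt_fderiv ((hT i).contDiffAt (hΩ.mem_nhds hp)))
  have h2 := hasFDerivAt_fderiv_apply hLp
    (hasFDerivAt_const ((0 : EuclideanSpace ℝ (Fin n)), EuclideanSpace.single i (1 : ℝ)) p)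
  have h3 := h2.unique (h1.congr_of_eventuallyEq
    (Filter.eventually_of_mem (hΩ.mem_nhds hp) fun q hq => (hTL q hq i).symm))
  have h4 := DFunLike.congr_fun h3 v
  simp at h4
  linarith

/-- The vertical logarithmic derivative of a function has symmetric vertical derivative. -/
theorem verticalDeriv_logDeriv_comm
    (hΩ : IsOpen Ω) (hL : ContDiffOn ℝ ∞ L Ω) (hT : ∀ i, ContDiffOn ℝ ∞ (T i) Ω)
    (hTL : ∀ p ∈ Ω, ∀ i, 2 * L p * T i p = dy i L p)
    (hnd : IsNondegenerateAt L p) (hp : p ∈ Ω) (i j : Fin n) :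
    verticalDeriv T i j p = verticalDeriv T j i p := by
  rw [← sub_eq_zero]
  refine eq_zero_of_mul_eventually_eq_zero (φ := fun p => verticalDeriv T i j p -
    verticalDeriv T j i p) hnd i ?_ ?_
  · exact ((contDiffOn_dy hΩ (hT i) j).continuousOn.continuousAt (hΩ.mem_nhds hp)).sub
      ((contDiffOn_dy hΩ (hT j) i).continuousOn.continuousAt (hΩ.mem_nhds hp))
  · filter_upwards [hΩ.mem_nhds hp] with q hq
    have h1 := two_mul_fderiv_logDeriv hΩ hL hT hTL hq i (0, EuclideanSpace.single j 1)
    have h2 := two_mul_fderiv_logDeriv hΩ hL hT hTL hq j (0, EuclideanSpace.single i 1)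
    rw [fderiv_fderiv_comm (hL.contDiffAt (hΩ.mem_nhds hq))] at h2
    have h3 := hTL q hq i
    have h4 := hTL q hq j
    unfold verticalDeriv
    unfold dy at h3 h4 ⊢
    -- The products of first derivatives become `4 L Tᵢ Tⱼ`, symmetric in the two indices, and
    -- cancel.
    rw [← h4] at h1
    rw [← h3] at h2
    linarith

/-- The vertical logarithmic derivative of a horizontally constant function is horizontally
constant. -/
theorem horizontalDeriv_logDeriv_eq_zero
    (hΩ : IsOpen Ω) (hL : ContDiffOn ℝ ∞ L Ω) (hT : ∀ i, ContDiffOn ℝ ∞ (T i) Ω)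
    (hTL : ∀ p ∈ Ω, ∀ i, 2 * L p * T i p = dy i L p)
    (h𝒢 : ContDiffOn ℝ ∞ 𝒢 Ω)
    (hH : ∀ p ∈ Ω, ∀ h, fderiv ℝ L p (h, -fderiv ℝ 𝒢 p (0, h)) = 0)
    (hnd : IsNondegenerateAt L p) (hp : p ∈ Ω) (i j : Fin n) :
    horizontalDeriv (fun i q => 𝒢 q i) T i j p = 0 := by
  refine eq_zero_of_mul_eventually_eq_zero (φ := horizontalDeriv (fun i q => 𝒢 q i) T i j) hnd i
    ?_ ?_
  · refine (contDiffOn_horizontalDeriv hΩ (fun r q hq => ?_) hT i j).continuousOn.continuousAt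
      (hΩ.mem_nhds hp)
    exact (contDiffAt_component (h𝒢.contDiffAt (hΩ.mem_nhds hq)) r).contDiffWithinAt
  · filter_upwards [hΩ.mem_nhds hp] with q hq
    have hLq := hL.contDiffAt (hΩ.mem_nhds hq)
    have h𝒢q := h𝒢.contDiffAt (hΩ.mem_nhds hq)
    set ei : EuclideanSpace ℝ (Fin n) := EuclideanSpace.single i 1 with hei
    set ej : EuclideanSpace ℝ (Fin n) := EuclideanSpace.single j 1 with hej
    have h1 := two_mul_fderiv_logDeriv hΩ hL hT hTL hq i (ej, -fderiv ℝ 𝒢 q (0, ej))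
    rw [hH q hq ej] at h1
    -- Differentiating horizontal constancy of `L` in the vertical direction `eᵢ` produces the
    -- Berwald term `Tᵣ Gʳᵢⱼ`.
    have h2 := fderiv_fderiv_add_eq hLq (hasFDerivAt_horizontal h𝒢q ej)
      (hasFDerivAt_const (0 : ℝ) q)
      (Filter.eventually_of_mem (hΩ.mem_nhds hq) fun z hz => hH z hz ej) (0, ei)
    change _ + fderiv ℝ L q (0, -fderiv ℝ (fderiv ℝ 𝒢) q (0, ei) (0, ej)) = 0 at h2
    rw [fderiv_fderiv_comm hLq, fderiv_fderiv_comm h𝒢q (0, ei),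
      show ((0, -fderiv ℝ (fderiv ℝ 𝒢) q (0, ej) (0, ei)) : EuclideanSpace ℝ (Fin n) × _) =
        -(0, fderiv ℝ (fderiv ℝ 𝒢) q (0, ej) (0, ei)) by simp, map_neg] at h2
    have h3 : ∑ r, dy j (fun z => 𝒢 z r) q * dy r (T i) q =
        fderiv ℝ (T i) q (0, fderiv ℝ 𝒢 q (0, ej)) := by
      rw [← sum_mul_dy]
      exact Finset.sum_congr rfl fun r _ =>
        congrArg (· * _) (fderiv_component (h𝒢q.differentiableAt (by simp)) r _)
    have h4 : 2 * L q * ∑ r, T r q * dy j (dy i fun z => 𝒢 z r) q =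
        fderiv ℝ L q (0, fderiv ℝ (fderiv ℝ 𝒢) q (0, ej) (0, ei)) := by
      rw [← sum_mul_dy, Finset.mul_sum]
      refine Finset.sum_congr rfl fun r _ => ?_
      have e : dy j (dy i fun z => 𝒢 z r) q = fderiv ℝ (fderiv ℝ 𝒢) q (0, ej) (0, ei) r :=
        (fderiv_fderiv_apply_const (contDiffAt_component h𝒢q r) _ _).trans
          (fderiv_fderiv_component h𝒢q r _ _)
      rw [← hTL q hq r, e]
      ring
    have h5 : fderiv ℝ (T i) q (ej, -fderiv ℝ 𝒢 q (0, ej)) =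
        dx j (T i) q - fderiv ℝ (T i) q (0, fderiv ℝ 𝒢 q (0, ej)) := by
      unfold dx
      rw [← map_sub]
      simp
      rfl
    unfold horizontalDeriv
    rw [h3, mul_sub, h4, ← h5]
    linarith

end ScalarCurvature

/-! ### Charts of the tangent bundle -/

section Charts

open Bundle Topology Set

theorem contMDiff_toTangent (n : ℕ) : ContMDiff
    𝓘(ℝ, EuclideanSpace ℝ (Fin n) × EuclideanSpace ℝ (Fin n)) (𝓡 n).tangent ∞
    (fun p : EuclideanSpace ℝ (Fin n) × EuclideanSpace ℝ (Fin n) =>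
      (⟨p.1, p.2⟩ : TangentBundle (𝓡 n) (EuclideanSpace ℝ (Fin n)))) := by
  have := contMDiff_tangentBundleModelSpaceHomeomorph_symm (I := 𝓡 n) (n := ∞)
  rw [modelWithCornersSelf_prod]
  exact this

theorem contMDiff_ofTangent (n : ℕ) : ContMDiff (𝓡 n).tangent
    𝓘(ℝ, EuclideanSpace ℝ (Fin n) × EuclideanSpace ℝ (Fin n)) ∞
    (fun v : TangentBundle (𝓡 n) (EuclideanSpace ℝ (Fin n)) =>
      ((v.proj, v.snd) : EuclideanSpace ℝ (Fin n) × EuclideanSpace ℝ (Fin n))) := by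
  have := contMDiff_tangentBundleModelSpaceHomeomorph (I := 𝓡 n) (n := ∞)
  rw [← modelWithCornersSelf_prod] at this
  exact this

theorem isOpen_tangentChartInv_domain {n : ℕ} {M : Type*} [TopologicalSpace M]
    (φ : OpenPartialHomeomorph M (EuclideanSpace ℝ (Fin n))) :
    IsOpen {p : EuclideanSpace ℝ (Fin n) × EuclideanSpace ℝ (Fin n) | p.1 ∈ φ.target} :=
  φ.open_target.preimage continuous_fst

variable {n : ℕ} {M : Type*} [TopologicalSpace M] [ChartedSpace (EuclideanSpace ℝ (Fin n)) M]
  {φ φ' : OpenPartialHomeomorph M (EuclideanSpace ℝ (Fin n))}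

theorem mdifferentiable_of_mem_maximalAtlas (hφ : φ ∈ IsManifold.maximalAtlas (𝓡 n) ∞ M) :
    φ.MDifferentiable (𝓡 n) (𝓡 n) :=
  ⟨(contMDiffOn_of_mem_maximalAtlas hφ).mdifferentiableOn (by simp),
    (contMDiffOn_symm_of_mem_maximalAtlas hφ).mdifferentiableOn (by simp)⟩

theorem tangentBundle_ext {v w : TangentBundle (𝓡 n) M} (h : v.proj = w.proj)
    (h' : (v.snd : EuclideanSpace ℝ (Fin n)) = w.snd) : v = w := by
  obtain ⟨x, a⟩ := v
  obtain ⟨y, b⟩ := w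
  obtain rfl : x = y := h
  obtain rfl : a = b := h'
  rfl

theorem tangentChart_smul (φ : OpenPartialHomeomorph M (EuclideanSpace ℝ (Fin n)))
    (v : TangentBundle (𝓡 n) M) (c : ℝ) :
    tangentChart φ ⟨v.proj, c • v.snd⟩ = ((tangentChart φ v).1, c • (tangentChart φ v).2) :=
  Prod.ext rfl ((mfderiv (𝓡 n) (𝓡 n) φ v.proj).map_smul c v.snd)

theorem contDiffAt_transition (hφ : φ ∈ IsManifold.maximalAtlas (𝓡 n) ∞ M)
    (hφ' : φ' ∈ IsManifold.maximalAtlas (𝓡 n) ∞ M) {x : EuclideanSpace ℝ (Fin n)}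
    (hx : x ∈ φ.target) (hx' : φ.symm x ∈ φ'.source) :
    ContDiffAt ℝ ∞ (fun x => φ' (φ.symm x)) x :=
  contMDiffAt_iff_contDiffAt.1 ((contMDiffAt_of_mem_maximalAtlas hφ' hx').comp x
    (contMDiffAt_symm_of_mem_maximalAtlas hφ hx))

theorem tangentChart_tangentChartInv (hφ : φ ∈ IsManifold.maximalAtlas (𝓡 n) ∞ M)
    {p : EuclideanSpace ℝ (Fin n) × EuclideanSpace ℝ (Fin n)} (hp : p.1 ∈ φ.target) :
    tangentChart φ (tangentChartInv φ p) = p :=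
  Prod.ext (φ.right_inv hp)
    (DFunLike.congr_fun ((mdifferentiable_of_mem_maximalAtlas hφ).comp_symm_deriv hp) p.2)

theorem tangentChartInv_tangentChart (hφ : φ ∈ IsManifold.maximalAtlas (𝓡 n) ∞ M)
    {v : TangentBundle (𝓡 n) M} (hv : v.proj ∈ φ.source) :
    tangentChartInv φ (tangentChart φ v) = v :=
  tangentBundle_ext (φ.left_inv hv)
    (DFunLike.congr_fun ((mdifferentiable_of_mem_maximalAtlas hφ).symm_comp_deriv hv) v.2)

theorem tangentChartInv_smul (φ : OpenPartialHomeomorph M (EuclideanSpace ℝ (Fin n)))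
    (p : EuclideanSpace ℝ (Fin n) × EuclideanSpace ℝ (Fin n)) (c : ℝ) :
    tangentChartInv φ (p.1, c • p.2) =
      ⟨(tangentChartInv φ p).proj, c • (tangentChartInv φ p).snd⟩ :=
  tangentBundle_ext rfl ((mfderiv (𝓡 n) (𝓡 n) φ.symm p.1).map_smul c p.2)

/-- The change of coordinates `(x, y) ↦ (ψ x, Dψ(x) y)` of the tangent bundle. -/
theorem tangentChart_comp_tangentChartInv (hφ : φ ∈ IsManifold.maximalAtlas (𝓡 n) ∞ M)
    (hφ' : φ' ∈ IsManifold.maximalAtlas (𝓡 n) ∞ M)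
    {p : EuclideanSpace ℝ (Fin n) × EuclideanSpace ℝ (Fin n)} (hp : p.1 ∈ φ.target)
    (hp' : φ.symm p.1 ∈ φ'.source) :
    tangentChart φ' (tangentChartInv φ p) =
      (φ' (φ.symm p.1), fderiv ℝ (fun x => φ' (φ.symm x)) p.1 p.2) := by
  refine Prod.ext rfl ?_
  have h := mfderiv_comp p.1
    ((mdifferentiable_of_mem_maximalAtlas hφ').mdifferentiableAt hp')
    ((mdifferentiable_of_mem_maximalAtlas hφ).mdifferentiableAt_symm hp)
  have h2 : mfderiv (𝓡 n) (𝓡 n) (φ' ∘ φ.symm) p.1 = fderiv ℝ (φ' ∘ φ.symm) p.1 :=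
    mfderiv_eq_fderiv
  rw [h2] at h
  exact (DFunLike.congr_fun h p.2).symm

theorem bijective_fderiv_transition (hφ : φ ∈ IsManifold.maximalAtlas (𝓡 n) ∞ M)
    (hφ' : φ' ∈ IsManifold.maximalAtlas (𝓡 n) ∞ M) {x : EuclideanSpace ℝ (Fin n)}
    (hx : x ∈ φ.target) (hx' : φ.symm x ∈ φ'.source) :
    Function.Bijective (fderiv ℝ (fun x => φ' (φ.symm x)) x) := by
  have h1 := (mdifferentiable_of_mem_maximalAtlas hφ').mfderiv_bijective hx'
  have h2 := (mdifferentiable_of_mem_maximalAtlas hφ).symm.mfderiv_bijective hx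
  have h := h1.comp h2
  have e : (fderiv ℝ (fun x => φ' (φ.symm x)) x : EuclideanSpace ℝ (Fin n) → _) =
      (mfderiv (𝓡 n) (𝓡 n) φ' (φ.symm x)) ∘ (mfderiv (𝓡 n) (𝓡 n) φ.symm x) := by
    funext y
    exact congrArg Prod.snd (tangentChart_comp_tangentChartInv hφ hφ' (p := (x, y)) hx hx').symm
  rw [e]
  exact h

variable [IsManifold (𝓡 n) ∞ M]

theorem contMDiffOn_tangentChart (hφ : φ ∈ IsManifold.maximalAtlas (𝓡 n) ∞ M) :
    ContMDiffOn (𝓡 n).tangent 𝓘(ℝ, EuclideanSpace ℝ (Fin n) × EuclideanSpace ℝ (Fin n)) ∞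
      (tangentChart φ) {v | v.proj ∈ φ.source} := by
  have := IsManifold.of_le (I := 𝓡 n) (M := M) (m := 1) (n := ∞) (by simp)
  have h1 := (contMDiffOn_of_mem_maximalAtlas hφ).contMDiffOn_tangentMapWithin (m := ∞) (by simp)
    φ.open_source.uniqueMDiffOn
  refine ((contMDiff_ofTangent n).comp_contMDiffOn h1).congr fun v hv => ?_
  have h : mfderivWithin (𝓡 n) (𝓡 n) φ φ.source v.proj = mfderiv (𝓡 n) (𝓡 n) φ v.proj :=
    mfderivWithin_of_isOpen φ.open_source hv
  exact Prod.ext rfl (DFunLike.congr_fun h v.snd).symm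

theorem contMDiffOn_tangentChartInv (hφ : φ ∈ IsManifold.maximalAtlas (𝓡 n) ∞ M) :
    ContMDiffOn 𝓘(ℝ, EuclideanSpace ℝ (Fin n) × EuclideanSpace ℝ (Fin n)) (𝓡 n).tangent ∞
      (tangentChartInv φ) {p | p.1 ∈ φ.target} := by
  have := IsManifold.of_le (I := 𝓡 n) (M := M) (m := 1) (n := ∞) (by simp)
  have h1 := (contMDiffOn_symm_of_mem_maximalAtlas hφ).contMDiffOn_tangentMapWithin (m := ∞)
    (by simp) φ.open_target.uniqueMDiffOn
  refine (h1.comp (contMDiff_toTangent n).contMDiffOn fun p hp => hp).congr fun p hp => ?_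
  have h : mfderivWithin (𝓡 n) (𝓡 n) φ.symm φ.target p.1 = mfderiv (𝓡 n) (𝓡 n) φ.symm p.1 :=
    mfderivWithin_of_isOpen φ.open_target hp
  exact tangentBundle_ext rfl (DFunLike.congr_fun h p.2).symm

theorem isOpen_tangentChart_domain (φ : OpenPartialHomeomorph M (EuclideanSpace ℝ (Fin n))) :
    IsOpen {v : TangentBundle (𝓡 n) M | v.proj ∈ φ.source} :=
  φ.open_source.preimage (FiberBundle.continuous_proj _ _)

theorem isOpen_coordDomain (hφ : φ ∈ IsManifold.maximalAtlas (𝓡 n) ∞ M)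
    {C : Set (TangentBundle (𝓡 n) M)} (hC : IsOpen C) : IsOpen (coordDomain φ C) :=
  (contMDiffOn_tangentChartInv hφ).continuousOn.isOpen_inter_preimage
    (isOpen_tangentChartInv_domain φ) hC

theorem contDiffOn_comp_tangentChartInv (hφ : φ ∈ IsManifold.maximalAtlas (𝓡 n) ∞ M)
    {C : Set (TangentBundle (𝓡 n) M)} {L : TangentBundle (𝓡 n) M → ℝ}
    (hL : ContMDiffOn (𝓡 n).tangent 𝓘(ℝ, ℝ) ∞ L C) :
    ContDiffOn ℝ ∞ (fun q => L (tangentChartInv φ q)) (coordDomain φ C) :=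
  contMDiffOn_iff_contDiffOn.1
    (hL.comp ((contMDiffOn_tangentChartInv hφ).mono fun _ hp => hp.1) fun _ hp => hp.2)

theorem contDiffOn_fieldInChart (hφ : φ ∈ IsManifold.maximalAtlas (𝓡 n) ∞ M)
    {C : Set (TangentBundle (𝓡 n) M)}
    {V : ∀ v : TangentBundle (𝓡 n) M, TangentSpace (𝓡 n).tangent v}
    (hV : ContMDiffOn (𝓡 n).tangent (𝓡 n).tangent.tangent ∞
      (fun v => (⟨v, V v⟩ : TangentBundle (𝓡 n).tangent (TangentBundle (𝓡 n) M))) C) :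
    ContDiffOn ℝ ∞ (fieldInChart V φ) (coordDomain φ C) := by
  have := IsManifold.of_le (I := 𝓡 n) (M := M) (m := 1) (n := ∞) (by simp)
  have := IsManifold.of_le (I := (𝓡 n).tangent) (M := TangentBundle (𝓡 n) M) (m := 1) (n := ∞)
    (by simp)
  have ho := isOpen_tangentChart_domain φ
  have h1 := (contMDiffOn_tangentChart hφ).contMDiffOn_tangentMapWithin (m := ∞) (by simp)
    ho.uniqueMDiffOn
  have h2 := (contMDiff_snd_tangentBundle_modelSpace (n := ∞)
    (EuclideanSpace ℝ (Fin n) × EuclideanSpace ℝ (Fin n))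
    𝓘(ℝ, EuclideanSpace ℝ (Fin n) × EuclideanSpace ℝ (Fin n))).comp_contMDiffOn h1
  have h3 : ContMDiffOn 𝓘(ℝ, EuclideanSpace ℝ (Fin n) × EuclideanSpace ℝ (Fin n))
      (𝓡 n).tangent.tangent ∞ (fun p => (⟨tangentChartInv φ p, V (tangentChartInv φ p)⟩ :
        TangentBundle (𝓡 n).tangent (TangentBundle (𝓡 n) M))) (coordDomain φ C) :=
    hV.comp ((contMDiffOn_tangentChartInv hφ).mono fun _ hp => hp.1) fun _ hp => hp.2
  have h4 : ∀ p ∈ coordDomain φ C, tangentChartInv φ p ∈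
      {v : TangentBundle (𝓡 n) M | v.proj ∈ φ.source} := fun p hp => φ.map_target hp.1
  refine contMDiffOn_iff_contDiffOn.1 ((h2.comp h3 h4).congr fun p hp => ?_)
  have h : mfderivWithin (𝓡 n).tangent
      𝓘(ℝ, EuclideanSpace ℝ (Fin n) × EuclideanSpace ℝ (Fin n)) (tangentChart φ)
      {v : TangentBundle (𝓡 n) M | v.proj ∈ φ.source} (tangentChartInv φ p) =
      mfderiv (𝓡 n).tangent 𝓘(ℝ, EuclideanSpace ℝ (Fin n) × EuclideanSpace ℝ (Fin n))
        (tangentChart φ) (tangentChartInv φ p) := mfderivWithin_of_isOpen ho (h4 p hp)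
  exact (DFunLike.congr_fun h (V (tangentChartInv φ p))).symm

/-- Allows the base point to be replaced by an equal one although the type of `V v` depends on it.
-/
theorem fieldInChart_eq (V : ∀ v : TangentBundle (𝓡 n) M, TangentSpace (𝓡 n).tangent v)
    {p : EuclideanSpace ℝ (Fin n) × EuclideanSpace ℝ (Fin n)} {v : TangentBundle (𝓡 n) M}
    (h : tangentChartInv φ p = v) :
    fieldInChart V φ p = mfderiv (𝓡 n).tangent
      𝓘(ℝ, EuclideanSpace ℝ (Fin n) × EuclideanSpace ℝ (Fin n)) (tangentChart φ) v (V v) := by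
  subst h
  rfl

/-- Near the given vector, the chart of `φ'` factors as the coordinate change after the chart of
`φ`; the claim is the chain rule for this factorisation. -/
theorem fieldInChart_transition (hφ : φ ∈ IsManifold.maximalAtlas (𝓡 n) ∞ M)
    (hφ' : φ' ∈ IsManifold.maximalAtlas (𝓡 n) ∞ M)
    (V : ∀ v : TangentBundle (𝓡 n) M, TangentSpace (𝓡 n).tangent v)
    {p : EuclideanSpace ℝ (Fin n) × EuclideanSpace ℝ (Fin n)} (hp : p.1 ∈ φ.target)
    (hp' : φ.symm p.1 ∈ φ'.source) :
    fieldInChart V φ' (tangentChart φ' (tangentChartInv φ p)) =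
      fderiv ℝ (fun q => tangentChart φ' (tangentChartInv φ q)) p (fieldInChart V φ p) := by
  have hv : (tangentChartInv φ p).proj ∈ φ'.source := hp'
  rw [fieldInChart_eq V (tangentChartInv_tangentChart hφ' hv), fieldInChart_eq V rfl]
  set v := tangentChartInv φ p with hvdef
  have hvφ : v.proj ∈ φ.source := φ.map_target hp
  have hd' : ContMDiffAt (𝓡 n).tangent _ ∞ (tangentChart φ') v :=
    (contMDiffOn_tangentChart hφ').contMDiffAt ((isOpen_tangentChart_domain φ').mem_nhds hv)
  have hd : ContMDiffAt (𝓡 n).tangent _ ∞ (tangentChart φ) v :=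
    (contMDiffOn_tangentChart hφ).contMDiffAt ((isOpen_tangentChart_domain φ).mem_nhds hvφ)
  have hi : ContMDiffAt _ (𝓡 n).tangent ∞ (tangentChartInv φ) p :=
    (contMDiffOn_tangentChartInv hφ).contMDiffAt ((isOpen_tangentChartInv_domain φ).mem_nhds hp)
  have hΨ : MDifferentiableAt 𝓘(ℝ, EuclideanSpace ℝ (Fin n) × EuclideanSpace ℝ (Fin n))
      𝓘(ℝ, EuclideanSpace ℝ (Fin n) × EuclideanSpace ℝ (Fin n))
      (fun q => tangentChart φ' (tangentChartInv φ q)) p :=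
    (hd'.comp p hi).mdifferentiableAt (by simp)
  have hpv : tangentChart φ v = p := tangentChart_tangentChartInv hφ hp
  have hcomp := mfderiv_comp_of_eq (x := v) (y := p) hΨ (hd.mdifferentiableAt (by simp)) hpv
  have heq : ((fun q => tangentChart φ' (tangentChartInv φ q)) ∘ tangentChart φ) =ᶠ[𝓝 v]
      tangentChart φ' := by
    filter_upwards [(isOpen_tangentChart_domain φ).mem_nhds hvφ] with w hw
    exact congrArg _ (tangentChartInv_tangentChart hφ hw)
  rw [heq.mfderiv_eq, mfderiv_eq_fderiv] at hcomp
  refine (DFunLike.congr_fun hcomp (V v)).trans ?_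
  change fderiv ℝ (fun q => tangentChart φ' (tangentChartInv φ q)) (tangentChart φ v) _ = _
  rw [hpv]
  rfl

end Charts

/-! ### Invariance under changes of coordinates -/

section Invariance

open Topology

variable {E : Type*} [NormedAddCommGroup E] [NormedSpace ℝ E]
  {ψ : E → E} {Ψ : E × E → E × E} {L : E × E → ℝ} {p : E × E}

theorem hasFDerivAt_tangentTransition (hψ : ContDiffAt ℝ ∞ ψ p.1) :
    HasFDerivAt (fun q : E × E => (ψ q.1, fderiv ℝ ψ q.1 q.2))
      (((fderiv ℝ ψ p.1).comp (ContinuousLinearMap.fst ℝ E E)).prod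
        ((fderiv ℝ ψ p.1).comp (ContinuousLinearMap.snd ℝ E E) +
          ((fderiv ℝ (fderiv ℝ ψ) p.1).comp (ContinuousLinearMap.fst ℝ E E)).flip p.2)) p := by
  refine ((hasFDerivAt_fderiv hψ).comp p hasFDerivAt_fst).prodMk ?_
  exact ((hasFDerivAt_fderiv (contDiffAt_fderiv hψ)).comp p hasFDerivAt_fst).clm_apply
    hasFDerivAt_snd

theorem fderiv_tangentTransition (hψ : ContDiffAt ℝ ∞ ψ p.1)
    (hΨ : ∀ᶠ q in 𝓝 p, Ψ q = (ψ q.1, fderiv ℝ ψ q.1 q.2)) (a b : E) :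
    fderiv ℝ Ψ p (a, b) =
      (fderiv ℝ ψ p.1 a, fderiv ℝ ψ p.1 b + fderiv ℝ (fderiv ℝ ψ) p.1 a p.2) := by
  rw [((hasFDerivAt_tangentTransition hψ).congr_of_eventuallyEq hΨ).fderiv]
  simp

theorem contDiffAt_tangentTransition (hψ : ContDiffAt ℝ ∞ ψ p.1)
    (hΨ : ∀ᶠ q in 𝓝 p, Ψ q = (ψ q.1, fderiv ℝ ψ q.1 q.2)) : ContDiffAt ℝ ∞ Ψ p := by
  refine ContDiffAt.congr_of_eventuallyEq (ContDiffAt.prodMk ?_ ?_) hΨ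
  · exact hψ.comp p contDiffAt_fst
  · exact ((contDiffAt_fderiv hψ).comp p contDiffAt_fst).clm_apply contDiffAt_snd

theorem fderiv_comp_tangentTransition (hψ : ContDiffAt ℝ ∞ ψ p.1)
    (hΨ : ∀ᶠ q in 𝓝 p, Ψ q = (ψ q.1, fderiv ℝ ψ q.1 q.2)) (hL : DifferentiableAt ℝ L (Ψ p))
    (v : E × E) :
    fderiv ℝ (fun q => L (Ψ q)) p v = fderiv ℝ L (Ψ p) (fderiv ℝ Ψ p v) := by
  have : HasFDerivAt (fun q => L (Ψ q)) _ p := hL.hasFDerivAt.comp p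
    ((contDiffAt_tangentTransition hψ hΨ).differentiableAt (by simp)).hasFDerivAt
  rw [this.fderiv]
  rfl

/-- A coordinate change sends the vertical vector `(0, h)` to the vertical vector `(0, Dψ h)`, so
differentiating once more adds a single term in `D²ψ`. -/
theorem fderiv_fderiv_comp_tangentTransition {O O' : Set (E × E)} (hO : IsOpen O)
    (hO' : IsOpen O') (hpO : p ∈ O) (hpO' : Ψ p ∈ O')
    (hψ : ∀ q ∈ O, ContDiffAt ℝ ∞ ψ q.1)
    (hΨ : ∀ q ∈ O, Ψ q = (ψ q.1, fderiv ℝ ψ q.1 q.2)) (hL : ContDiffOn ℝ ∞ L O')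
    (v : E × E) (h : E) :
    fderiv ℝ (fderiv ℝ fun q => L (Ψ q)) p v (0, h) =
      fderiv ℝ (fderiv ℝ L) (Ψ p) (fderiv ℝ Ψ p v) (0, fderiv ℝ ψ p.1 h) +
        fderiv ℝ L (Ψ p) (0, fderiv ℝ (fderiv ℝ ψ) p.1 v.1 h) := by
  have hev : ∀ q ∈ O, ∀ᶠ q in 𝓝 q, Ψ q = (ψ q.1, fderiv ℝ ψ q.1 q.2) := fun q hq =>
    Filter.eventually_of_mem (hO.mem_nhds hq) hΨ
  have hΨp := contDiffAt_tangentTransition (hψ p hpO) (hev p hpO)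
  have hLp := hL.contDiffAt (hO'.mem_nhds hpO')
  have hLΨ : ContDiffAt ℝ ∞ (fun q => L (Ψ q)) p := hLp.comp p hΨp
  rw [← fderiv_fderiv_apply_const hLΨ]
  have heq : (fun q => fderiv ℝ (fun q => L (Ψ q)) q (0, h)) =ᶠ[𝓝 p]
      fun q => fderiv ℝ L (Ψ q) (0, fderiv ℝ ψ q.1 h) := by
    filter_upwards [hO.mem_nhds hpO, hΨp.continuousAt.preimage_mem_nhds (hO'.mem_nhds hpO')]
      with q hq hq'
    rw [fderiv_comp_tangentTransition (hψ q hq) (hev q hq)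
      ((hL.contDiffAt (hO'.mem_nhds hq')).differentiableAt (by simp)),
      fderiv_tangentTransition (hψ q hq) (hev q hq)]
    simp
  have h1 : HasFDerivAt (fun q : E × E => fderiv ℝ ψ q.1 h)
      (((fderiv ℝ (fderiv ℝ ψ) p.1).comp (ContinuousLinearMap.fst ℝ E E)).flip h) p := by
    have := ((hasFDerivAt_fderiv (contDiffAt_fderiv (hψ p hpO))).comp p
      hasFDerivAt_fst).clm_apply (hasFDerivAt_const h p)
    simpa using this
  have h2 := ((hasFDerivAt_fderiv (contDiffAt_fderiv hLp)).comp p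
    (hasFDerivAt_fderiv hΨp)).clm_apply ((hasFDerivAt_const (0 : E) p).prodMk h1)
  have h3 : HasFDerivAt (fun q => fderiv ℝ L (Ψ q) (0, fderiv ℝ ψ q.1 h)) _ p := h2
  rw [heq.fderiv_eq, h3.fderiv]
  simp [add_comm]

/-- For two vertical arguments the `D²ψ` term is absent: the Hessian is pulled back by the bijection
`Dψ`. -/
theorem isNondegenerateAt_comp {O O' : Set (E × E)} (hO : IsOpen O)
    (hO' : IsOpen O') (hpO : p ∈ O) (hpO' : Ψ p ∈ O')
    (hψ : ∀ q ∈ O, ContDiffAt ℝ ∞ ψ q.1)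
    (hΨ : ∀ q ∈ O, Ψ q = (ψ q.1, fderiv ℝ ψ q.1 q.2)) (hL : ContDiffOn ℝ ∞ L O')
    (hbij : Function.Bijective (fderiv ℝ ψ p.1)) (hnd : IsNondegenerateAt L (Ψ p)) :
    IsNondegenerateAt (fun q => L (Ψ q)) p := by
  intro k hk
  refine (map_eq_zero_iff _ hbij.1).1 (hnd (fderiv ℝ ψ p.1 k) fun h => ?_)
  obtain ⟨h, rfl⟩ := hbij.2 h
  have := hk h
  rw [fderiv_fderiv_comp_tangentTransition hO hO' hpO hpO' hψ hΨ hL,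
    fderiv_tangentTransition (hψ p hpO) (Filter.eventually_of_mem (hO.mem_nhds hpO) hΨ)] at this
  simpa [Prod.mk_zero_zero] using this

/-- Both sides acquire a term in `D²ψ`, one with arguments `(y, h)` and the other with `(h, y)`;
symmetry of the second derivative makes them agree. -/
theorem isEulerLagrange_comp {𝒢 𝒢' : E × E → E} {O O' : Set (E × E)} (hO : IsOpen O)
    (hO' : IsOpen O') (hpO : p ∈ O) (hpO' : Ψ p ∈ O')
    (hψ : ∀ q ∈ O, ContDiffAt ℝ ∞ ψ q.1)
    (hΨ : ∀ q ∈ O, Ψ q = (ψ q.1, fderiv ℝ ψ q.1 q.2)) (hL : ContDiffOn ℝ ∞ L O')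
    (h𝒢 : sprayVector 𝒢 (Ψ p) = fderiv ℝ Ψ p (sprayVector 𝒢' p))
    (hEL : IsEulerLagrange 𝒢 L (Ψ p)) : IsEulerLagrange 𝒢' (fun q => L (Ψ q)) p := by
  intro h
  have hev := Filter.eventually_of_mem (hO.mem_nhds hpO) hΨ
  rw [fderiv_fderiv_comp_tangentTransition hO hO' hpO hpO' hψ hΨ hL, ← h𝒢, hEL,
    fderiv_comp_tangentTransition (hψ p hpO) hev
      ((hL.contDiffAt (hO'.mem_nhds hpO')).differentiableAt (by simp)),
    fderiv_tangentTransition (hψ p hpO) hev, map_zero, zero_add, prod_split _ (fderiv ℝ ψ p.1 h)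
      (fderiv ℝ (fderiv ℝ ψ) p.1 h p.2)]
  exact congrArg (fun z => _ + fderiv ℝ L (Ψ p) (0, z)) (fderiv_fderiv_comm (hψ p hpO) p.2 h)

end Invariance

/-! ### Sprays of scalar curvature on manifolds -/

section Main

open Topology Set

variable {n : ℕ} {M : Type*} [TopologicalSpace M] [ChartedSpace (EuclideanSpace ℝ (Fin n)) M]
  {φ : OpenPartialHomeomorph M (EuclideanSpace ℝ (Fin n))}
  {C : Set (TangentBundle (𝓡 n) M)} {U : Set M} {L : TangentBundle (𝓡 n) M → ℝ}
  {R : TangentBundle (𝓡 n) M → ℝ}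
  {τ : ∀ v : TangentBundle (𝓡 n) M, TangentSpace (𝓡 n) v.proj →L[ℝ] ℝ}

theorem coordDomain_mono {C' : Set (TangentBundle (𝓡 n) M)} (h : C ⊆ C') :
    coordDomain φ C ⊆ coordDomain φ C' := fun _ hp => ⟨hp.1, h hp.2⟩

theorem exists_mem_coordDomain (C : Set (TangentBundle (𝓡 n) M)) {v : TangentBundle (𝓡 n) M}
    (hv : v ∈ C) (hφ : φ ∈ IsManifold.maximalAtlas (𝓡 n) ∞ M) (hvφ : v.proj ∈ φ.source) :
    ∃ p ∈ coordDomain φ C, tangentChartInv φ p = v := by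
  have h := tangentChartInv_tangentChart hφ hvφ
  exact ⟨tangentChart φ v, ⟨φ.map_source hvφ, by rwa [h]⟩, h⟩

theorem exists_covectorComponent_ne_zero (hφ : φ ∈ IsManifold.maximalAtlas (𝓡 n) ∞ M)
    {p : EuclideanSpace ℝ (Fin n) × EuclideanSpace ℝ (Fin n)} (hp : p.1 ∈ φ.target)
    (hτ : τ (tangentChartInv φ p) ≠ 0) : ∃ k, covectorComponent φ τ k p ≠ 0 := by
  by_contra! h
  refine hτ (ContinuousLinearMap.ext fun w => ?_)
  obtain ⟨y, rfl⟩ := (mdifferentiable_of_mem_maximalAtlas hφ).symm.mfderiv_surjective hp w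
  exact eq_zero_of_apply_single ((τ (tangentChartInv φ p)).toLinearMap ∘ₗ
    (mfderiv (𝓡 n) (𝓡 n) φ.symm p.1).toLinearMap) h y

variable [IsManifold (𝓡 n) ∞ M] {G : Spray n M}

/-- The spray coefficients in a chart, as a vector valued function. -/
def Spray.vectorCoeff (G : Spray n M) (φ : OpenPartialHomeomorph M (EuclideanSpace ℝ (Fin n)))
    (p : EuclideanSpace ℝ (Fin n) × EuclideanSpace ℝ (Fin n)) : EuclideanSpace ℝ (Fin n) :=
  (-1 / 2 : ℝ) • (fieldInChart G.field φ p).2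

theorem Spray.vectorCoeff_apply (G : Spray n M)
    (φ : OpenPartialHomeomorph M (EuclideanSpace ℝ (Fin n))) :
    (fun i q => G.vectorCoeff φ q i) = G.coeff φ := rfl

theorem Spray.sprayVector_vectorCoeff (G : Spray n M)
    (hφ : φ ∈ IsManifold.maximalAtlas (𝓡 n) ∞ M)
    {p : EuclideanSpace ℝ (Fin n) × EuclideanSpace ℝ (Fin n)} (hp : p ∈ coordDomain φ G.region) :
    sprayVector (G.vectorCoeff φ) p = fieldInChart G.field φ p := by
  refine Prod.ext (G.second_order φ hφ p hp).symm ?_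
  simp only [sprayVector, Spray.vectorCoeff, smul_smul]
  norm_num

theorem Spray.contDiffOn_vectorCoeff (G : Spray n M)
    (hφ : φ ∈ IsManifold.maximalAtlas (𝓡 n) ∞ M) :
    ContDiffOn ℝ ∞ (G.vectorCoeff φ) (coordDomain φ G.region) :=
  (contDiff_snd.comp_contDiffOn (contDiffOn_fieldInChart hφ G.smooth)).const_smul _

theorem smul_mem_coordDomain (hC : IsConicalRegion U C)
    {p : EuclideanSpace ℝ (Fin n) × EuclideanSpace ℝ (Fin n)} (hp : p ∈ coordDomain φ C)
    {c : ℝ} (hc : 0 < c) : (p.1, c • p.2) ∈ coordDomain φ C := by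
  refine ⟨hp.1, ?_⟩
  rw [tangentChartInv_smul]
  exact hC.smul_mem _ hp.2 c hc

theorem IsFinslerMetric.contDiffAt
    (hφ : φ ∈ IsManifold.maximalAtlas (𝓡 n) ∞ M) (hL : IsFinslerMetric U C L)
    {p : EuclideanSpace ℝ (Fin n) × EuclideanSpace ℝ (Fin n)}
    (hp : p ∈ coordDomain φ C) : ContDiffAt ℝ ∞ (fun q => L (tangentChartInv φ q)) p :=
  (contDiffOn_comp_tangentChartInv hφ hL.smooth).contDiffAt
    ((isOpen_coordDomain hφ hL.isConicalRegion.isOpen).mem_nhds hp)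

theorem IsFinslerMetric.isNondegenerateAt
    (hφ : φ ∈ IsManifold.maximalAtlas (𝓡 n) ∞ M) (hL : IsFinslerMetric U C L)
    {p : EuclideanSpace ℝ (Fin n) × EuclideanSpace ℝ (Fin n)} (hp : p ∈ coordDomain φ C) :
    IsNondegenerateAt (fun q => L (tangentChartInv φ q)) p :=
  (det_fundamentalTensor_ne_zero_iff (hL.contDiffAt hφ hp)).1 (hL.nondegenerate φ hφ p hp)

theorem IsFinslerMetric.fderiv_radial
    (hφ : φ ∈ IsManifold.maximalAtlas (𝓡 n) ∞ M) (hL : IsFinslerMetric U C L)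
    {p : EuclideanSpace ℝ (Fin n) × EuclideanSpace ℝ (Fin n)} (hp : p ∈ coordDomain φ C) :
    fderiv ℝ (fun q => L (tangentChartInv φ q)) p (0, p.2) = 2 * L (tangentChartInv φ p) := by
  refine fderiv_radial_of_homogeneous (isOpen_coordDomain hφ hL.isConicalRegion.isOpen)
    ((contDiffOn_comp_tangentChartInv hφ hL.smooth).differentiableOn (by simp))
    (fun q hq c hc => ?_) hp
  rw [tangentChartInv_smul]
  exact hL.homogeneous _ hq.2 c hc

theorem IsFinslerMetric.isEulerLagrange
    (hφ : φ ∈ IsManifold.maximalAtlas (𝓡 n) ∞ M) (hL : IsFinslerMetric U C L)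
    (hind : G.IsInducedBy C L)
    {p : EuclideanSpace ℝ (Fin n) × EuclideanSpace ℝ (Fin n)} (hp : p ∈ coordDomain φ C) :
    IsEulerLagrange (G.vectorCoeff φ) (fun q => L (tangentChartInv φ q)) p :=
  (isEulerLagrange_iff (hL.contDiffAt hφ hp) (hL.nondegenerate φ hφ p hp)).2 (hind φ hφ p hp)

theorem IsFinslerMetric.curvature_mul_dy
    (hφ : φ ∈ IsManifold.maximalAtlas (𝓡 n) ∞ M) (hL : IsFinslerMetric U C L)
    (hCG : C ⊆ G.region) (hind : G.IsInducedBy C L)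
    (hG : G.IsOfScalarCurvature R τ)
    {p : EuclideanSpace ℝ (Fin n) × EuclideanSpace ℝ (Fin n)} (hp : p ∈ coordDomain φ C)
    (k : Fin n) :
    R (tangentChartInv φ p) * dy k (fun q => L (tangentChartInv φ q)) p =
      2 * covectorComponent φ τ k p * L (tangentChartInv φ p) :=
  scalarCurvature_mul_dy (R := fun q => R (tangentChartInv φ q))
    (T := covectorComponent φ τ) (L := fun q => L (tangentChartInv φ q))
    (isOpen_coordDomain hφ hL.isConicalRegion.isOpen)
    (contDiffOn_comp_tangentChartInv hφ hL.smooth)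
    ((G.contDiffOn_vectorCoeff hφ).mono (coordDomain_mono hCG))
    (fun _ hq => hL.fderiv_radial hφ hq) (fun _ hq => hL.isEulerLagrange hφ hind hq)
    (fun q hq => hG.curvature_eq φ hφ q (coordDomain_mono hCG hq)) hp k

/-- A spray with `R = 0` and `τ ≠ 0` is not metrizable. -/
theorem not_isFinslerMetrizableOn_of_curvature_eq_zero (hG : G.IsOfScalarCurvature R τ)
    (hR : ∀ v ∈ C, R v = 0) (hτ : ∃ v ∈ C, τ v ≠ 0) : ¬ G.IsFinslerMetrizableOn U C := by
  rintro ⟨hCG, L, hL, hind⟩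
  obtain ⟨v, hv, hτv⟩ := hτ
  obtain ⟨φ, hφ, hvφ⟩ : ∃ φ ∈ IsManifold.maximalAtlas (𝓡 n) ∞ M, v.proj ∈ φ.source :=
    ⟨_, IsManifold.chart_mem_maximalAtlas v.proj, mem_chart_source _ v.proj⟩
  obtain ⟨p, hp, rfl⟩ := exists_mem_coordDomain C hv hφ hvφ
  obtain ⟨k, hk⟩ := exists_covectorComponent_ne_zero hφ hp.1 hτv
  have hΩ := isOpen_coordDomain hφ hL.isConicalRegion.isOpen
  -- By continuity `τₖ ≠ 0` near `p`, where `2 τₖ L = R ∂̇ₖL = 0` forces `L = 0`.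
  refine not_eventually_eq_zero_of_isNondegenerateAt (hL.isNondegenerateAt hφ hp) k ?_
  have hc := (((hG.smooth_τ _ hφ k).mono (coordDomain_mono hCG)).continuousOn.continuousAt
    (hΩ.mem_nhds hp)).eventually_ne hk
  filter_upwards [hc, hΩ.mem_nhds hp] with q hq hqΩ
  have h1 := hL.curvature_mul_dy hφ hCG hind hG hqΩ k
  rw [hR _ hqΩ.2, zero_mul] at h1
  simpa [hq] using h1.symm

/-- A metrizable spray of scalar curvature with `R ≠ 0` has horizontally constant `τ / R`, with
symmetric vertical derivative. -/
theorem IsFinslerMetrizableOn.quotientComponent_deriv (hG : G.IsOfScalarCurvature R τ)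
    (h : G.IsFinslerMetrizableOn U C) (hφ : φ ∈ IsManifold.maximalAtlas (𝓡 n) ∞ M)
    {p : EuclideanSpace ℝ (Fin n) × EuclideanSpace ℝ (Fin n)} (hp : p ∈ coordDomain φ C)
    (hRp : R (tangentChartInv φ p) ≠ 0) (i j : Fin n) :
    horizontalDeriv (G.coeff φ) (quotientComponent R τ φ) i j p = 0 ∧
      verticalDeriv (quotientComponent R τ φ) i j p =
        verticalDeriv (quotientComponent R τ φ) j i p := by
  obtain ⟨hCG, L, hL, hind⟩ := h
  have hΩ := isOpen_coordDomain hφ hL.isConicalRegion.isOpen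
  have hRsm : ContDiffOn ℝ ∞ (fun q => R (tangentChartInv φ q)) (coordDomain φ C) :=
    (contDiffOn_comp_tangentChartInv hφ hG.smooth_R).mono (coordDomain_mono hCG)
  have hLsm := contDiffOn_comp_tangentChartInv hφ hL.smooth
  have h𝒢sm := (G.contDiffOn_vectorCoeff hφ).mono (coordDomain_mono hCG)
  -- The quotient is smooth, and equal to half the logarithmic derivative, only where `R ≠ 0`; this
  -- open set contains `p`.
  let O := coordDomain φ C ∩ (fun q => R (tangentChartInv φ q)) ⁻¹' {0}ᶜ
  have hO : IsOpen O := hRsm.continuousOn.isOpen_inter_preimage hΩ isOpen_compl_singleton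
  have hpO : p ∈ O := ⟨hp, hRp⟩
  have hQ : ∀ i, ContDiffOn ℝ ∞ (quotientComponent R τ φ i) O := fun i =>
    (((hG.smooth_τ _ hφ i).mono (coordDomain_mono hCG)).mono inter_subset_left).div
      (hRsm.mono inter_subset_left) fun q hq => hq.2
  have hQL : ∀ q ∈ O, ∀ i, 2 * L (tangentChartInv φ q) * quotientComponent R τ φ i q =
      dy i (fun q => L (tangentChartInv φ q)) q := by
    intro q hq i
    have h1 := hL.curvature_mul_dy hφ hCG hind hG hq.1 i
    have h2 : R (tangentChartInv φ q) ≠ 0 := hq.2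
    unfold quotientComponent
    field_simp
    linarith
  have hnd := hL.isNondegenerateAt hφ hp
  refine ⟨?_, verticalDeriv_logDeriv_comm hO (hLsm.mono inter_subset_left) hQ hQL hnd hpO i j⟩
  exact horizontalDeriv_logDeriv_eq_zero hO (hLsm.mono inter_subset_left) hQ hQL
    (h𝒢sm.mono inter_subset_left)
    (fun q hq h => fderiv_horizontal_eq_zero hΩ hLsm h𝒢sm (fun _ hq => hL.fderiv_radial hφ hq)
      (fun _ hq => hL.isEulerLagrange hφ hind hq) hq.1 h) hnd hpO i j

theorem riemannVector_eq_zero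
    {𝒢 : EuclideanSpace ℝ (Fin n) × EuclideanSpace ℝ (Fin n) → EuclideanSpace ℝ (Fin n)}
    {p : EuclideanSpace ℝ (Fin n) × EuclideanSpace ℝ (Fin n)} (h𝒢 : ContDiffAt ℝ ∞ 𝒢 p)
    (h : ∀ i k, riemannCurvature (fun i q => 𝒢 q i) i k p = 0) (v : EuclideanSpace ℝ (Fin n)) :
    riemannVector 𝒢 p v = 0 := by
  -- The curvature is linear in `h`, so its vanishing can be checked on the standard basis.
  let T : EuclideanSpace ℝ (Fin n) →L[ℝ] EuclideanSpace ℝ (Fin n) :=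
    (2 : ℝ) • (fderiv ℝ 𝒢 p).comp (ContinuousLinearMap.inl ℝ _ _) -
      (fderiv ℝ (fderiv ℝ 𝒢) p (sprayVector 𝒢 p)).comp (ContinuousLinearMap.inr ℝ _ _) -
      (connection 𝒢 p).comp (connection 𝒢 p)
  refine eq_zero_of_apply_single T.toLinearMap (fun k => ?_) v
  ext i
  exact (riemannCurvature_eq h𝒢 i k).symm.trans (h i k)

/-- A metric in one coordinate system that induces the spray there yields a Finsler metric on the
manifold inducing the spray. -/
theorem isFinslerMetrizableOn_of_chart (hφ : φ ∈ IsManifold.maximalAtlas (𝓡 n) ∞ M)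
    {U₀ : Set (EuclideanSpace ℝ (Fin n))}
    {C₀ : Set (EuclideanSpace ℝ (Fin n) × EuclideanSpace ℝ (Fin n))}
    {L₀ : EuclideanSpace ℝ (Fin n) × EuclideanSpace ℝ (Fin n) → ℝ}
    (hC₀ : IsOpen C₀) (hC₀G : C₀ ⊆ coordDomain φ G.region) (hproj : Prod.fst '' C₀ = U₀)
    (hcone : ∀ p ∈ C₀, ∀ c : ℝ, 0 < c → (p.1, c • p.2) ∈ C₀) (hL₀ : ContDiffOn ℝ ∞ L₀ C₀)
    (hhom : ∀ p ∈ C₀, ∀ c : ℝ, 0 < c → L₀ (p.1, c • p.2) = c ^ 2 * L₀ p)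
    (h : ∀ p ∈ C₀, L₀ p ≠ 0 ∧ IsEulerLagrange (G.vectorCoeff φ) L₀ p ∧ IsNondegenerateAt L₀ p) :
    G.IsFinslerMetrizableOn (φ.source ∩ φ ⁻¹' U₀)
      {v | v.proj ∈ φ.source ∧ tangentChart φ v ∈ C₀} := by
  set C : Set (TangentBundle (𝓡 n) M) := {v | v.proj ∈ φ.source ∧ tangentChart φ v ∈ C₀} with hCdef
  have hC : IsOpen C := (contMDiffOn_tangentChart hφ).continuousOn.isOpen_inter_preimage
    (isOpen_tangentChart_domain φ) hC₀
  have hCG : C ⊆ G.region := fun v hv => by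
    have := (hC₀G hv.2).2
    rwa [tangentChartInv_tangentChart hφ hv.1] at this
  have hregion : IsConicalRegion (φ.source ∩ φ ⁻¹' U₀) C := by
    refine ⟨hC, fun v hv => G.isConicalRegion.ne_zero v (hCG hv), fun v hv c hc => ⟨hv.1, ?_⟩, ?_⟩
    · rw [tangentChart_smul]
      exact hcone _ hv.2 c hc
    · ext y
      constructor
      · rintro ⟨v, hv, rfl⟩
        exact ⟨hv.1, hproj ▸ ⟨_, hv.2, rfl⟩⟩
      · rintro ⟨hy, hyU⟩
        rw [mem_preimage, ← hproj] at hyU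
        obtain ⟨p, hp, hpy⟩ := hyU
        have hpt : p.1 ∈ φ.target := (hC₀G hp).1
        have e : φ.symm p.1 = y := by rw [hpy, φ.left_inv hy]
        refine ⟨tangentChartInv φ p, ⟨φ.map_target hpt, ?_⟩, e⟩
        rwa [tangentChart_tangentChartInv hφ hpt]
  have hsm : ContMDiffOn (𝓡 n).tangent 𝓘(ℝ, ℝ) ∞ (fun v => L₀ (tangentChart φ v)) C :=
    hL₀.contMDiffOn.comp ((contMDiffOn_tangentChart hφ).mono fun v hv => hv.1) fun v hv => hv.2
  -- The definitions quantify over every chart, while `L₀` is controlled in one. In `φ'` the metric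
  -- reads as `L₀` composed with the coordinate change, so invariance applies.
  have hchart : ∀ φ' ∈ IsManifold.maximalAtlas (𝓡 n) ∞ M, ∀ p ∈ coordDomain φ' C,
      IsNondegenerateAt (fun q => L₀ (tangentChart φ (tangentChartInv φ' q))) p ∧
      IsEulerLagrange (G.vectorCoeff φ')
        (fun q => L₀ (tangentChart φ (tangentChartInv φ' q))) p := by
    intro φ' hφ' p hp
    have hO := isOpen_coordDomain hφ' hC
    have hψ : ∀ q ∈ coordDomain φ' C, ContDiffAt ℝ ∞ (fun x => φ (φ'.symm x)) q.1 :=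
      fun q hq => contDiffAt_transition hφ' hφ hq.1 hq.2.1
    have hΨ : ∀ q ∈ coordDomain φ' C, tangentChart φ (tangentChartInv φ' q) =
        (φ (φ'.symm q.1), fderiv ℝ (fun x => φ (φ'.symm x)) q.1 q.2) :=
      fun q hq => tangentChart_comp_tangentChartInv hφ' hφ hq.1 hq.2.1
    refine ⟨isNondegenerateAt_comp hO hC₀ hp hp.2.2 hψ hΨ hL₀
      (bijective_fderiv_transition hφ' hφ hp.1 hp.2.1) (h _ hp.2.2).2.2,
      isEulerLagrange_comp (𝒢 := G.vectorCoeff φ) hO hC₀ hp hp.2.2 hψ hΨ hL₀ ?_ (h _ hp.2.2).2.1⟩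
    rw [G.sprayVector_vectorCoeff hφ' (coordDomain_mono hCG hp),
      G.sprayVector_vectorCoeff hφ (hC₀G hp.2.2)]
    exact fieldInChart_transition hφ' hφ G.field hp.1 hp.2.1
  have hcd : ∀ φ' ∈ IsManifold.maximalAtlas (𝓡 n) ∞ M, ∀ p ∈ coordDomain φ' C,
      ContDiffAt ℝ ∞ (fun q => L₀ (tangentChart φ (tangentChartInv φ' q))) p :=
    fun φ' hφ' p hp => (contDiffOn_comp_tangentChartInv hφ' hsm).contDiffAt
      ((isOpen_coordDomain hφ' hC).mem_nhds hp)
  have hdet : ∀ φ' ∈ IsManifold.maximalAtlas (𝓡 n) ∞ M, ∀ p ∈ coordDomain φ' C,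
      (fundamentalTensor (fun q => L₀ (tangentChart φ (tangentChartInv φ' q))) p).det ≠ 0 :=
    fun φ' hφ' p hp => (det_fundamentalTensor_ne_zero_iff (hcd φ' hφ' p hp)).2
      (hchart φ' hφ' p hp).1
  refine ⟨hCG, fun v => L₀ (tangentChart φ v), ⟨hregion, hsm, fun v hv c hc => ?_, hdet,
    fun x hx => ?_⟩, fun φ' hφ' p hp => ?_⟩
  · rw [tangentChart_smul]
    exact hhom _ hv.2 c hc
  · rw [← hregion.proj_image] at hx
    obtain ⟨v, hv, rfl⟩ := hx
    exact ⟨v, hv, rfl, (h _ hv.2).1⟩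
  · exact (isEulerLagrange_iff (hcd φ' hφ' p hp) (hdet φ' hφ' p hp)).1 (hchart φ' hφ' p hp).2

/-- A spray with vanishing Riemann curvature is locally metrizable. -/
theorem isLocallyFinslerMetrizable_of_flat (hG : G.IsOfScalarCurvature R τ)
    (h : ∀ v ∈ G.region, R v = 0 ∧ τ v = 0) : G.IsLocallyFinslerMetrizable := by
  intro x
  have hx : x ∈ (fun v : TangentBundle (𝓡 n) M => v.proj) '' G.region := by
    rw [G.isConicalRegion.proj_image]
    trivial
  obtain ⟨v, hv, rfl⟩ := hx
  set φ := chartAt (EuclideanSpace ℝ (Fin n)) v.proj with hφdef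
  have hφ : φ ∈ IsManifold.maximalAtlas (𝓡 n) ∞ M := IsManifold.chart_mem_maximalAtlas v.proj
  have hvφ : v.proj ∈ φ.source := mem_chart_source _ v.proj
  have hv₀ : (φ v.proj, (tangentChart φ v).2) ∈ coordDomain φ G.region :=
    ⟨φ.map_source hvφ, by
      change tangentChartInv φ (tangentChart φ v) ∈ _
      rwa [tangentChartInv_tangentChart hφ hvφ]⟩
  have hΩ := isOpen_coordDomain hφ G.isConicalRegion.isOpen
  have h𝒢 := G.contDiffOn_vectorCoeff hφ
  obtain ⟨U₀, C₀, L₀, hU₀, hxU₀, hC₀, hC₀G, hproj, hcone, hL₀, hhom, hmetric⟩ :=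
    exists_local_metric hΩ h𝒢
      (fun p hp c hc => smul_mem_coordDomain G.isConicalRegion hp hc)
      (fun p hp h0 => G.isConicalRegion.ne_zero _ hp.2 (by
        change mfderiv (𝓡 n) (𝓡 n) φ.symm p.1 p.2 = 0
        rw [h0]
        exact map_zero (mfderiv (𝓡 n) (𝓡 n) φ.symm p.1)))
      (fun p hp c hc => by
        ext i
        exact G.homogeneous φ hφ p hp i c hc)
      (fun p hp => riemannVector_eq_zero (h𝒢.contDiffAt (hΩ.mem_nhds hp)) fun i k => by
        have hτ : covectorComponent φ τ k p = 0 := by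
          unfold covectorComponent
          rw [(h _ hp.2).2]
          rfl
        rw [Spray.vectorCoeff_apply, hG.curvature_eq φ hφ p hp, (h _ hp.2).1, hτ]
        ring)
      hv₀
  exact ⟨φ.source ∩ φ ⁻¹' U₀, φ.continuousOn.isOpen_inter_preimage φ.open_source hU₀,
    ⟨hvφ, hxU₀⟩, _, isFinslerMetrizableOn_of_chart hφ hC₀ hC₀G hproj hcone hL₀ hhom hmetric⟩

end Main

end SprayGeometry

end

theorem theorem3p5 {n : ℕ} {M : Type*} [TopologicalSpace M]
    [ChartedSpace (EuclideanSpace ℝ (Fin n)) M] [IsManifold (𝓡 n) ∞ M]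
    (G : SprayGeometry.Spray n M) (R : TangentBundle (𝓡 n) M → ℝ)
    (τ : ∀ v : TangentBundle (𝓡 n) M, TangentSpace (𝓡 n) v.proj →L[ℝ] ℝ)
    (hG : G.IsOfScalarCurvature R τ) :
    ((∀ v ∈ G.region, R v = 0 ∧ τ v = 0) → G.IsLocallyFinslerMetrizable) ∧
    (∀ (U : Set M) (C : Set (TangentBundle (𝓡 n) M)),
      (∀ v ∈ C, R v = 0) → (∃ v ∈ C, τ v ≠ 0) → ¬ G.IsFinslerMetrizableOn U C) ∧
    (∀ (U : Set M) (C : Set (TangentBundle (𝓡 n) M)),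
      (∃ φ ∈ IsManifold.maximalAtlas (𝓡 n) ∞ M, ∃ p ∈ SprayGeometry.coordDomain φ C,
        R (SprayGeometry.tangentChartInv φ p) ≠ 0 ∧
        ∃ i j : Fin n,
          SprayGeometry.horizontalDeriv (G.coeff φ)
            (SprayGeometry.quotientComponent R τ φ) i j p ≠ 0 ∨
          SprayGeometry.verticalDeriv (SprayGeometry.quotientComponent R τ φ) i j p ≠
            SprayGeometry.verticalDeriv (SprayGeometry.quotientComponent R τ φ) j i p) →
      ¬ G.IsFinslerMetrizableOn U C) := by
  refine ⟨SprayGeometry.isLocallyFinslerMetrizable_of_flat hG,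
    fun U C => SprayGeometry.not_isFinslerMetrizableOn_of_curvature_eq_zero hG, ?_⟩
  rintro U C ⟨φ, hφ, p, hp, hRp, i, j, h⟩ hmet
  have key := SprayGeometry.IsFinslerMetrizableOn.quotientComponent_deriv hG hmet hφ hp hRp i j
  exact h.elim (fun h => h key.1) fun h => h key.2
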